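/- Let $p\ge 1$, $q\ge 0$, $a_0>0$, $a_1,\dots,a_p\ge 0$, $b_1,\dots,b_q\ge 0$ with $\sum_{i=1}^p a_i+\sum_{j=1}^q b_j<1$. Let $\rho$ be a probability distribution on $\mathbb N_0$ with mean $1$ and finite variance, and let $\varphi$ be the characteristic function of a probability distribution on $\mathbb R$ that is differentiable at $0$ with $\varphi'(0)\neq 0$. A compounding CMEM (conditional-mean multiplicative operator model) with linear INGARCH mean consists of random variables $X_t,\epsilon_t,Z_{t,j}\in\mathbb N_0$ and $M_t>0$ ($t\in\mathbb Z$, $j\ge 1$) on a probability space such that, almost surely for every $t$, $$X_t=M_t\bullet\epsilon_t:=\sum_{j=1}^{\epsilon_t}Z_{t,j},\qquad M_t=a_0+\sum_{i=1}^p a_iX_{t-i}+\sum_{j=1}^q b_jM_{t-j},$$ and, with $\mathcal F_{t-1}$ the $\sigma$-field generated by $(X_s,M_s)$, $s<t$: the $\epsilon_t$ are i.i.d. with distribution $\rho$; for every $t$, $\epsilon_t$ is independent of the $\sigma$-field generated by $\mathcal F_{t-1}$ and $(Z_{t,j})_{j\ge1}$; and, conditionally on $\mathcal F_{t-1}$,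 the integrable variables $Z_{t,1},Z_{t,2},\dots$ are i.i.d. with mean $M_t$. Its counting series is said to be of CP-INGARCH type with characteristic function $\varphi$ if $$E\big[e^{iuZ_{t,j}}\,\big|\,\mathcal F_{t-1}\big]=\exp\Big\{\frac{iM_t\,[\varphi(u)-1]}{\varphi'(0)}\Big\}\quad\text{a.s., for all }u\in\mathbb R,\ t\in\mathbb Z,\ j\ge1 .$$ (i) Every compounding CMEM of this kind with counting series of CP-INGARCH type with characteristic function $\varphi$ and with $\sup_{t\in\mathbb Z}E[X_t]<\infty$ has a strictly stationary and ergodic count process $(X_t)_{t\in\mathbb Z}$. (ii) If for every $m>0$ the function $u\mapsto\exp\{i\,m\,[\varphi(u)-1]/\varphi'(0)\}$ is the characteristic function of a probability distribution on $\mathbb N_0$, then a compounding CMEM as in (i) exists; that is, the model has a strictly stationary and ergodic solution with $\sup_{t\in\mathbb Z}E[X_t]<\infty$. -/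

import Mathlib

open MeasureTheory ProbabilityTheory
open scoped ENNReal NNReal

noncomputable section

namespace CMEM

/-- The law of a count process `(X_t)`, `t ∈ ℤ`, as a measure on the path space `ℤ → ℕ`. -/
def pathLaw {Ω : Type*} [MeasurableSpace Ω] (X : ℤ → Ω → ℕ) (μ : Measure Ω) :
    Measure (ℤ → ℕ) :=
  μ.map (fun ω t => X t ω)

/-- The left shift on the path space. -/
def shift (x : ℤ → ℕ) : ℤ → ℕ := fun t => x (t + 1)

/-- Strict stationarity: all finite-dimensional distributions are invariant under time shifts. -/
def IsStrictlyStationary {Ω : Type*} [MeasurableSpace Ω] (X : ℤ → Ω → ℕ) (μ : Measure Ω) : Prop :=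
  ∀ (n : ℕ) (τ : Fin n → ℤ) (h : ℤ),
    μ.map (fun ω i => X (τ i + h) ω) = μ.map (fun ω i => X (τ i) ω)

/-- Ergodicity: the shift is measure preserving and ergodic for the law of the process. -/
def IsErgodicProcess {Ω : Type*} [MeasurableSpace Ω] (X : ℤ → Ω → ℕ) (μ : Measure Ω) : Prop :=
  Ergodic shift (pathLaw X μ)

/-- The sigma-field `F_{t-1}`, generated by the pairs `(X_s, M_s)` with `s < t`. -/
@[reducible] def past {Ω : Type*} (X : ℤ → Ω → ℕ) (M : ℤ → Ω → ℝ) (t : ℤ) : MeasurableSpace Ω :=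
  ⨆ s : {s : ℤ // s < t}, MeasurableSpace.comap (fun ω => (X s ω, M s ω)) inferInstance

/-- Conditional independence, given the sigma-field `m`, of a sequence of count variables. -/
def CondIndepSeq {Ω : Type*} (m : MeasurableSpace Ω) [MeasurableSpace Ω] (Y : ℕ → Ω → ℕ)
    (μ : Measure Ω) : Prop :=
  ∀ (s : Finset ℕ) (A : ℕ → Set ℕ),
    μ⟦⋂ j ∈ s, Y j ⁻¹' A j | m⟧ =ᵐ[μ] ∏ j ∈ s, μ⟦Y j ⁻¹' A j | m⟧

/-- The function `u ↦ exp (i m (φ(u) - 1) / φ'(0))`. -/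
def cpCharFun (φ : ℝ → ℂ) (m : ℝ) (u : ℝ) : ℂ :=
  Complex.exp (Complex.I * (m : ℂ) * (φ u - 1) / deriv φ 0)

/-- For every `m > 0`, `cpCharFun φ m` is the characteristic function of a probability
distribution on the nonnegative integers. -/
def GeneratesCounts (φ : ℝ → ℂ) : Prop :=
  ∀ m : ℝ, 0 < m → ∃ κ : Measure ℕ, IsProbabilityMeasure κ ∧
    ∀ u : ℝ, charFun (κ.map (fun k : ℕ => (k : ℝ))) u = cpCharFun φ m u

/-- `(X_t)` is a compounding CMEM with linear INGARCH mean: `X_t = M_t • ε_t` is the sum of the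
first `ε_t` members of the counting series `Z_{t,0}, Z_{t,1}, …`. -/
structure IsCompoundingCMEM {Ω : Type*} [MeasurableSpace Ω] (μ : Measure Ω) {p q : ℕ}
    (a₀ : ℝ) (a : Fin p → ℝ) (b : Fin q → ℝ) (ρ : Measure ℕ)
    (X : ℤ → Ω → ℕ) (M : ℤ → Ω → ℝ) (ε : ℤ → Ω → ℕ) (Z : ℤ → ℕ → Ω → ℕ) : Prop where
  measurable_X : ∀ t, Measurable (X t)
  measurable_M : ∀ t, Measurable (M t)
  measurable_ε : ∀ t, Measurable (ε t)
  measurable_Z : ∀ t j, Measurable (Z t j)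
  /-- The conditional means are positive. -/
  M_pos : ∀ t, ∀ᵐ ω ∂μ, 0 < M t ω
  /-- The linear recursion
  `M_t = a₀ + a₁ X_{t-1} + … + a_p X_{t-p} + b₁ M_{t-1} + … + b_q M_{t-q}`. -/
  M_rec : ∀ t, ∀ᵐ ω ∂μ, M t ω = a₀ + ∑ i : Fin p, a i * (X (t - 1 - (i : ℤ)) ω : ℝ)
    + ∑ j : Fin q, b j * M (t - 1 - (j : ℤ)) ω
  /-- The compounding operator. -/
  X_eq : ∀ t, ∀ᵐ ω ∂μ, X t ω = ∑ j ∈ Finset.range (ε t ω), Z t j ω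
  /-- The innovations are i.i.d. with distribution `ρ`. -/
  ε_indep : iIndepFun ε μ
  ε_law : ∀ t, μ.map (ε t) = ρ
  /-- `ε_t` is independent of `F_{t-1}` and of the counting series at time `t`, jointly. -/
  ε_indep_past : ∀ t, Indep (MeasurableSpace.comap (ε t) inferInstance)
    (past X M t ⊔ ⨆ j, MeasurableSpace.comap (Z t j) inferInstance) μ
  /-- Given `F_{t-1}`, the counting series at time `t` is i.i.d. with mean `M_t`. -/
  Z_condIndep : ∀ t, CondIndepSeq (past X M t) (Z t) μ
  Z_condIdent : ∀ t j (A : Set ℕ),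
    μ⟦Z t j ⁻¹' A | past X M t⟧ =ᵐ[μ] μ⟦Z t 0 ⁻¹' A | past X M t⟧
  Z_integrable : ∀ t j, Integrable (fun ω => (Z t j ω : ℝ)) μ
  Z_condMean : ∀ t j, μ[fun ω => (Z t j ω : ℝ) | past X M t] =ᵐ[μ] M t

/-- The counting series is of CP-INGARCH type, with the deterministic and time-independent `φ`:
the conditional characteristic function of `Z_{t,j}` given `F_{t-1}` is
`u ↦ exp (i M_t (φ(u) - 1) / φ'(0))`. -/
def HasCPCountingSeries {Ω : Type*} [MeasurableSpace Ω] (μ : Measure Ω) (φ : ℝ → ℂ)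
    (X : ℤ → Ω → ℕ) (M : ℤ → Ω → ℝ) (Z : ℤ → ℕ → Ω → ℕ) : Prop :=
  ∀ (t : ℤ) (j : ℕ) (u : ℝ),
    μ[fun ω => Complex.exp (Complex.I * (u : ℂ) * (Z t j ω : ℂ)) | past X M t]
      =ᵐ[μ] fun ω => cpCharFun φ (M t ω) u

/-- The means `E[X_t]` are bounded, uniformly in `t ∈ ℤ`. -/
def HasBoundedMeans {Ω : Type*} [MeasurableSpace Ω] (μ : Measure Ω) (X : ℤ → Ω → ℕ) : Prop :=
  ∃ C : ℝ≥0, ∀ t, ∫⁻ ω, (X t ω : ℝ≥0∞) ∂μ ≤ C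

end CMEM

end

noncomputable section

namespace CMEM

/-! Write `φ = charFun Q`. Since `φ (-u)` is the conjugate of `φ u`, `φ'(0) = i c` with `c` real,
and the prescribed function is `exp ((m / c) (φ - 1))`. If `c > 0`, this is the characteristic
function of a compound Poisson law with rate `m / c` and jump law `Q`. Under (ii), or given any
solution, these functions belong to laws `κ m` on `ℕ`, which form a convolution semigroup with means
`m` (`exists_countSemigroup`). For a given solution, bounded modulus forces `c > 0`, and a mixture
of compound Poisson laws lives on `ℕ` only if `Q` does (`generatesCounts_of_solution`).

By the semigroup property `κ m` increases stochastically with `m`. If all counting variables are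
realised as quantiles of common uniform variables, the compounded count is monotone in `m`, and two
counts with means `m`, `m'` are at `L¹` distance exactly `|m - m'|`
(`lintegral_enorm_compound_sub`). This identity carries the stability argument.

Existence: Picard iteration from zero, driven by i.i.d. innovations, increases with means bounded by
a constant. Quantiles are left-continuous in `m`, so the limit solves the recursion
(`ae_solMean_eq`). It commutes with the time shift, hence its law is a factor of a Bernoulli shift
and is ergodic (`ergodic_shiftSeq`, `ergodic_sol`).

Uniqueness in law: the histories of every solution evolve, in law, by one fixed random map applied
with fresh innovations (`map_prodMk_count`). Two solutions with bounded means are started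
independently in the far past and driven by the same innovations. Because the coefficients sum to
less than one, their `L¹` distance decays geometrically (`lintegral_coupling_le`); counts being
integers, they disagree with vanishing probability. So every solution has the law of the constructed
one, and with it stationarity and ergodicity. -/

/-! ### Laws on `ℕ`: the mean from the characteristic function -/

theorem deriv_charFun_zero_re (Q : Measure ℝ) [IsFiniteMeasure Q]
    (h : DifferentiableAt ℝ (charFun Q) 0) : (deriv (charFun Q) 0).re = 0 := by
  have h1 : HasDerivAt (charFun Q) (deriv (charFun Q) 0) (-0) := by
    simpa using h.hasDerivAt
  have h2 := h1.scomp (0 : ℝ) (hasDerivAt_neg (0 : ℝ))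
  have h3 : HasDerivAt (fun u => (starRingEnd ℂ) (charFun Q u))
      ((starRingEnd ℂ) (deriv (charFun Q) 0)) 0 :=
    (Complex.conjCLE.toContinuousLinearMap.hasFDerivAt.comp_hasDerivAt (0 : ℝ) h.hasDerivAt)
  -- Differentiating this identity at `0` gives `-d = conj d`, so the real part of `d` vanishes.
  have h4 : (charFun Q ∘ Neg.neg) = fun u => (starRingEnd ℂ) (charFun Q u) := by
    ext u
    simp [charFun_neg]
  rw [h4] at h2
  have h5 := congrArg Complex.re (h2.unique h3)
  simp at h5
  linarith

theorem charFun_map_natCast (κ : Measure ℕ) (u : ℝ) :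
    charFun (κ.map (fun k : ℕ => (k : ℝ))) u = ∫ k : ℕ, Complex.exp (u * k * Complex.I) ∂κ := by
  rw [charFun_apply_real, integral_map .of_discrete (by fun_prop)]
  simp

theorem integrable_exp_mul_natCast (κ : Measure ℕ) [IsFiniteMeasure κ] (u : ℝ) :
    Integrable (fun k : ℕ => Complex.exp (u * k * Complex.I)) κ := by
  refine Integrable.of_bound (C := 1) .of_discrete (.of_forall fun k => ?_)
  have : ((u : ℂ) * k * Complex.I) = ((u * k : ℝ) : ℂ) * Complex.I := by push_cast; ring
  rw [this, Complex.norm_exp_ofReal_mul_I]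

theorem charFun_map_natCast_im (κ : Measure ℕ) [IsFiniteMeasure κ] (u : ℝ) :
    (charFun (κ.map (fun k : ℕ => (k : ℝ))) u).im = ∫ k : ℕ, Real.sin (u * k) ∂κ := by
  rw [charFun_map_natCast]
  have h := (Complex.imCLM.integral_comp_comm (integrable_exp_mul_natCast κ u)).symm
  simp only [Complex.imCLM_apply] at h
  rw [h]
  congr 1 with k
  have : ((u : ℂ) * k * Complex.I) = ((u * k : ℝ) : ℂ) * Complex.I := by push_cast; ring
  rw [this, Complex.exp_ofReal_mul_I_im]

theorem integral_sin_mul (h : ℝ) (k : ℕ) :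
    ∫ u in (0 : ℝ)..h, Real.sin (u * k) = (1 - Real.cos (h * k)) / k := by
  rcases Nat.eq_zero_or_pos k with rfl | hk
  · simp
  · have : (k : ℝ) ≠ 0 := by positivity
    rw [intervalIntegral.integral_comp_mul_right _ this, integral_sin]
    simp
    field_simp

/-- A law on the nonnegative integers whose characteristic function has difference quotients
bounded near `0` has finite mean. -/
theorem lintegral_natCast_lt_top (κ : Measure ℕ) [IsProbabilityMeasure κ] {d : ℂ}
    (hd : HasDerivAt (charFun (κ.map (fun k : ℕ => (k : ℝ)))) d 0) :
    ∫⁻ k, (k : ℝ≥0∞) ∂κ < ∞ := by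
  have : IsProbabilityMeasure (κ.map (fun k : ℕ => (k : ℝ))) :=
    Measure.isProbabilityMeasure_map .of_discrete
  obtain ⟨C, hC0, hC⟩ := hd.isBigO_sub.exists_pos
  obtain ⟨δ, hδ, hball⟩ := Metric.eventually_nhds_iff.1 hC.bound
  -- The value at `0` is real, so the imaginary part alone inherits the linear bound.
  have him : ∀ u : ℝ, |u| < δ → ∫ k : ℕ, Real.sin (u * k) ∂κ ≤ C * |u| := by
    intro u hu
    have h1 := hball (y := u) (by simpa using hu)
    rw [← charFun_map_natCast_im]
    calc (charFun (κ.map (fun k : ℕ => (k : ℝ))) u).im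
        = (charFun (κ.map (fun k : ℕ => (k : ℝ))) u
            - charFun (κ.map (fun k : ℕ => (k : ℝ))) 0).im := by
          rw [charFun_zero]; simp
      _ ≤ _ := Complex.im_le_norm _
      _ ≤ _ := by simpa using h1
  -- The sine changes sign; integrating over `u` in `[0, h]` replaces it by the nonnegative `(1 -
  -- cos (h k)) / k`.
  have hJ : ∀ h : ℝ, 0 < h → h < δ → ∫ k : ℕ, (1 - Real.cos (h * k)) / k ∂κ ≤ C * h ^ 2 / 2 := by
    intro h h0 hδ'
    have hint : Integrable (Function.uncurry fun (u : ℝ) (k : ℕ) => Real.sin (u * k))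
        ((volume.restrict (Set.uIoc 0 h)).prod κ) := by
      have : IsFiniteMeasure (volume.restrict (Set.uIoc 0 h)) := by
        rw [Set.uIoc_of_le h0.le]; infer_instance
      refine Integrable.of_bound (C := 1) ?_ (.of_forall fun k => ?_)
      · apply Measurable.aestronglyMeasurable
        fun_prop
      · exact Real.abs_sin_le_one _
    have hsw := intervalIntegral_integral_swap hint
    simp only [integral_sin_mul] at hsw
    rw [← hsw]
    calc ∫ u in (0 : ℝ)..h, ∫ k : ℕ, Real.sin (u * k) ∂κ ≤ ∫ u in (0 : ℝ)..h, C * u := by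
          apply intervalIntegral.integral_mono_on h0.le
          · rw [intervalIntegrable_iff]
            exact hint.integral_prod_left
          · exact (continuous_const.mul continuous_id).intervalIntegrable _ _
          · intro u hu
            have := him u (by rw [abs_of_nonneg hu.1]; linarith [hu.2])
            rwa [abs_of_nonneg hu.1] at this
      _ = C * h ^ 2 / 2 := by
          rw [intervalIntegral.integral_const_mul, integral_id]; ring
  -- With `h ≤ π / (K + 1)`, every `k ≤ K` satisfies `1 - cos (h k) ≥ 2 (h k)² / π²`. The resulting
  -- factor `1 / h²` cancels the `h²` of `hJ`, so the bound does not depend on `K`.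
  have hpart : ∀ K : ℕ, ∫⁻ k in Set.Iic K, (k : ℝ≥0∞) ∂κ ≤ ENNReal.ofReal (C * Real.pi ^ 2) := by
    intro K
    set h : ℝ := min (δ / 2) (Real.pi / (K + 1)) with hh
    have h0 : 0 < h := by rw [hh]; exact lt_min (by linarith) (by positivity)
    have h1 : h < δ := (min_le_left _ _).trans_lt (by linarith)
    have h2 : ∀ k : ℕ, k ≤ K → (k : ℝ) ≤ Real.pi ^ 2 / (2 * h ^ 2) * ((1 - Real.cos (h * k)) / k) := by
      intro k hk
      rcases Nat.eq_zero_or_pos k with rfl | hk0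
      · simp
      have hk0' : (0 : ℝ) < k := by exact_mod_cast hk0
      have h3 : |h * k| ≤ Real.pi := by
        rw [abs_of_nonneg (by positivity)]
        have h4 : (k : ℝ) ≤ K + 1 := by exact_mod_cast hk.trans (Nat.le_succ _)
        calc h * k ≤ Real.pi / (K + 1) * (K + 1) := by
              apply mul_le_mul (min_le_right _ _) h4 hk0'.le (by positivity)
          _ = Real.pi := by field_simp
      have h5 := Real.cos_le_one_sub_mul_cos_sq h3
      have h6 : 2 / Real.pi ^ 2 * (h * k) ^ 2 ≤ 1 - Real.cos (h * k) := by linarith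
      calc (k : ℝ) = Real.pi ^ 2 / (2 * h ^ 2) * ((2 / Real.pi ^ 2 * (h * k) ^ 2) / k) := by
            have := Real.pi_pos
            field_simp
        _ ≤ _ := by gcongr
    have hnn : ∀ k : ℕ, 0 ≤ (1 - Real.cos (h * k)) / k := fun k =>
      div_nonneg (by linarith [Real.cos_le_one (h * k)]) (by positivity)
    have hint : Integrable (fun k : ℕ => (1 - Real.cos (h * k)) / (k : ℝ)) κ := by
      refine Integrable.of_bound (C := 2) .of_discrete (.of_forall fun k => ?_)
      rw [Real.norm_of_nonneg (hnn k)]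
      rcases Nat.eq_zero_or_pos k with rfl | hk0
      · simp
      · have : (1 : ℝ) ≤ k := by exact_mod_cast hk0
        rw [div_le_iff₀ (by linarith)]
        nlinarith [Real.neg_one_le_cos (h * k)]
    calc ∫⁻ k in Set.Iic K, (k : ℝ≥0∞) ∂κ
        ≤ ∫⁻ k in Set.Iic K,
            ENNReal.ofReal (Real.pi ^ 2 / (2 * h ^ 2) * ((1 - Real.cos (h * k)) / k)) ∂κ := by
          apply setLIntegral_mono' (by measurability)
          intro k hk
          rw [← ENNReal.ofReal_natCast]
          exact ENNReal.ofReal_le_ofReal (h2 k hk)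
      _ ≤ ∫⁻ k, ENNReal.ofReal (Real.pi ^ 2 / (2 * h ^ 2) * ((1 - Real.cos (h * k)) / k)) ∂κ :=
          setLIntegral_le_lintegral _ _
      _ = ENNReal.ofReal (∫ k, Real.pi ^ 2 / (2 * h ^ 2) * ((1 - Real.cos (h * k)) / k) ∂κ) := by
          rw [ofReal_integral_eq_lintegral_ofReal (hint.const_mul _)]
          exact .of_forall fun k => mul_nonneg (by positivity) (hnn k)
      _ ≤ ENNReal.ofReal (C * Real.pi ^ 2) := by
          apply ENNReal.ofReal_le_ofReal
          rw [integral_const_mul]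
          calc _ ≤ Real.pi ^ 2 / (2 * h ^ 2) * (C * h ^ 2 / 2) := by
                gcongr; exact hJ h h0 h1
            _ = C * Real.pi ^ 2 / 4 := by field_simp; norm_num
            _ ≤ _ := by nlinarith [mul_pos hC0 (pow_pos Real.pi_pos 2)]
  refine lt_of_le_of_lt ?_ (ENNReal.ofReal_lt_top (r := C * Real.pi ^ 2))
  have hU : (Set.univ : Set ℕ) = ⋃ K : ℕ, Set.Iic K := by
    ext k; simp
  rw [← setLIntegral_univ, hU]
  have hdir : Monotone fun K : ℕ => Set.Iic K := fun i j hij => Set.Iic_subset_Iic.2 hij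
  rw [setLIntegral_iUnion_of_directed _ hdir.directed_le]
  exact iSup_le hpart

/-- Differentiability at `0` does not give a first moment for general real laws; nonnegativity
supplies it. Once the mean is finite, the derivative is `i` times the mean. -/
theorem lintegral_natCast_of_hasDerivAt (κ : Measure ℕ) [IsProbabilityMeasure κ] {c : ℝ}
    (hd : HasDerivAt (charFun (κ.map (fun k : ℕ => (k : ℝ)))) (Complex.I * c) 0) :
    ∫⁻ k, (k : ℝ≥0∞) ∂κ = ENNReal.ofReal c := by
  have : IsProbabilityMeasure (κ.map (fun k : ℕ => (k : ℝ))) :=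
    Measure.isProbabilityMeasure_map .of_discrete
  have hfin := lintegral_natCast_lt_top κ hd
  have hint : Integrable (fun k : ℕ => (k : ℝ)) κ := by
    refine ⟨.of_discrete, ?_⟩
    rw [hasFiniteIntegral_iff_enorm]
    convert hfin using 2 with k
    simp
  have hmem : MemLp id ((1 : ℕ) : ℝ≥0∞) (κ.map (fun k : ℕ => (k : ℝ))) := by
    rw [Nat.cast_one, memLp_one_iff_integrable,
      integrable_map_measure (by fun_prop) .of_discrete]
    exact hint
  have h := iteratedDeriv_charFun_zero hmem
  rw [iteratedDeriv_one, hd.deriv, integral_map .of_discrete (by fun_prop)] at h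
  simp only [pow_one] at h
  have h2 : c = ∫ k : ℕ, (k : ℝ) ∂κ := by
    have := mul_left_cancel₀ Complex.I_ne_zero h
    exact_mod_cast this
  rw [h2, ofReal_integral_eq_lintegral_ofReal hint (.of_forall fun k => by positivity)]
  simp

/-! ### The sign of `φ'(0)` and the semigroup of counting laws -/

/-- A convolution semigroup of laws on the nonnegative integers, parametrised by the mean. -/
structure IsCountSemigroup (κ : ℝ≥0 → Measure ℕ) : Prop where
  prob : ∀ m, IsProbabilityMeasure (κ m)
  conv : ∀ m h, κ (m + h) = κ m ∗ κ h
  mean : ∀ m, ∫⁻ k, (k : ℝ≥0∞) ∂(κ m) = m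

/-- For `c > 0` and `m ≥ 0` this displays the compound Poisson form: rate `m / c`, jumps with
characteristic function `φ`. -/
theorem cpCharFun_eq_exp {φ : ℝ → ℂ} {c : ℝ} (hc : deriv φ 0 = Complex.I * c) (m u : ℝ) :
    cpCharFun φ m u = Complex.exp (((m / c : ℝ) : ℂ) * (φ u - 1)) := by
  unfold cpCharFun
  congr 1
  rw [hc, mul_assoc, mul_div_mul_left _ _ Complex.I_ne_zero]
  push_cast
  ring

/-- The modulus is `exp ((m / c) (Re φ - 1))`. If `c < 0`, the bound gives `Re φ u ≥ 1 ≥ |φ u|` for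
all `u`, so `φ` is constantly `1` and its derivative vanishes. The witness `m` may depend on `u`,
which suits bounds known only almost surely for each `u`. -/
theorem exists_deriv_charFun_eq (Q : Measure ℝ) [IsProbabilityMeasure Q]
    (hdiff : DifferentiableAt ℝ (charFun Q) 0) (hderiv : deriv (charFun Q) 0 ≠ 0)
    (hbound : ∀ u, ∃ m : ℝ, 0 < m ∧ ‖cpCharFun (charFun Q) m u‖ ≤ 1) :
    ∃ c : ℝ, 0 < c ∧ deriv (charFun Q) 0 = Complex.I * c := by
  have hre := deriv_charFun_zero_re Q hdiff
  set d := deriv (charFun Q) 0 with hd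
  have hdI : d = Complex.I * (d.im : ℝ) := by
    apply Complex.ext <;> simp [hre]
  refine ⟨d.im, ?_, hdI⟩
  by_contra hneg
  have him : d.im ≠ 0 := fun h0 => hderiv (by rw [hdI, h0]; simp)
  have hlt : d.im < 0 := lt_of_le_of_ne (not_lt.1 hneg) him
  have hone : ∀ u, charFun Q u = 1 := by
    intro u
    obtain ⟨m, hm, h1⟩ := hbound u
    rw [cpCharFun_eq_exp hdI, Complex.norm_exp, Complex.re_ofReal_mul, Real.exp_le_one_iff] at h1
    have h2 : 0 ≤ (charFun Q u - 1).re := by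
      by_contra h3
      exact absurd h1 (not_le.2 (mul_pos_of_neg_of_neg (div_neg_of_pos_of_neg hm hlt)
        (not_le.1 h3)))
    have h3 : 1 ≤ (charFun Q u).re := by simpa using h2
    have h4 := norm_charFun_le_one (μ := Q) u
    have h5 := Complex.sq_norm (charFun Q u)
    rw [Complex.normSq_apply] at h5
    have h6 : ‖charFun Q u‖ ^ 2 ≤ 1 := by
      have := norm_nonneg (charFun Q u); nlinarith
    apply Complex.ext
    · simp; nlinarith [mul_self_nonneg (charFun Q u).im]
    · simp; nlinarith [mul_self_nonneg (charFun Q u).im]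
  apply hderiv
  have : charFun Q = fun _ => 1 := funext hone
  rw [hd, this]
  simp

theorem hasDerivAt_cpCharFun {φ : ℝ → ℂ} (hdiff : DifferentiableAt ℝ φ 0)
    (hderiv : deriv φ 0 ≠ 0) (h0 : φ 0 = 1) (m : ℝ) :
    HasDerivAt (cpCharFun φ m) (Complex.I * m) 0 := by
  have h1 := ((hdiff.hasDerivAt.sub_const 1).const_mul (Complex.I * m)).div_const (deriv φ 0)
  have h2 := h1.cexp
  simp only [h0, sub_self, mul_zero, zero_div, Complex.exp_zero, one_mul] at h2
  rw [mul_div_cancel_right₀ _ hderiv] at h2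
  exact h2

theorem eq_of_charFun_map_natCast {κ κ' : Measure ℕ} [IsFiniteMeasure κ] [IsFiniteMeasure κ']
    (h : ∀ u, charFun (κ.map (fun k : ℕ => (k : ℝ))) u
      = charFun (κ'.map (fun k : ℕ => (k : ℝ))) u) : κ = κ' := by
  apply (MeasurableEmbedding.natCast (α := ℝ)).map_injective
  exact Measure.ext_of_charFun (funext h)

theorem charFun_map_natCast_conv (κ κ' : Measure ℕ) [IsFiniteMeasure κ] [IsFiniteMeasure κ']
    (u : ℝ) : charFun ((κ ∗ κ').map (fun k : ℕ => (k : ℝ))) u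
      = charFun (κ.map (fun k : ℕ => (k : ℝ))) u * charFun (κ'.map (fun k : ℕ => (k : ℝ))) u := by
  have : (fun k : ℕ => (k : ℝ)) = (Nat.castAddMonoidHom ℝ : ℕ → ℝ) := rfl
  rw [this, Measure.map_conv_addMonoidHom _ (by fun_prop), charFun_conv]

/-- The exponent is additive in `m`, which gives the convolution property, and its derivative at `0`
is `i m`, which gives the mean. -/
theorem exists_countSemigroup (Q : Measure ℝ) [IsProbabilityMeasure Q]
    (hdiff : DifferentiableAt ℝ (charFun Q) 0) (hderiv : deriv (charFun Q) 0 ≠ 0)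
    (hgen : GeneratesCounts (charFun Q)) :
    ∃ κ : ℝ≥0 → Measure ℕ, IsCountSemigroup κ ∧
      ∀ (m : ℝ≥0) u, charFun ((κ m).map (fun k : ℕ => (k : ℝ))) u
        = cpCharFun (charFun Q) m u := by
  have hex : ∀ m : ℝ≥0, ∃ κ : Measure ℕ, IsProbabilityMeasure κ ∧
      ∀ u : ℝ, charFun (κ.map (fun k : ℕ => (k : ℝ))) u = cpCharFun (charFun Q) m u := by
    intro m
    -- `GeneratesCounts` only speaks of `m > 0`; the unit mass at `0` completes the family.
    rcases eq_or_ne m 0 with rfl | hm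
    · refine ⟨Measure.dirac 0, inferInstance, fun u => ?_⟩
      rw [charFun_map_natCast]
      simp [cpCharFun]
    · exact hgen m (by positivity)
  choose κ hprob hκ using hex
  refine ⟨κ, ⟨hprob, fun m h => ?_, fun m => ?_⟩, hκ⟩
  · apply eq_of_charFun_map_natCast
    intro u
    rw [charFun_map_natCast_conv, hκ, hκ, hκ]
    simp only [cpCharFun]
    rw [← Complex.exp_add]
    congr 1
    push_cast
    ring
  · have h1 := hasDerivAt_cpCharFun hdiff hderiv (by simp) (m : ℝ)
    have h2 : charFun ((κ m).map (fun k : ℕ => (k : ℝ))) = cpCharFun (charFun Q) m :=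
      funext (hκ m)
    rw [← h2] at h1
    rw [lintegral_natCast_of_hasDerivAt _ h1, ENNReal.ofReal_coe_nnreal]

/-! ### Dependence of the distribution functions on the mean -/

namespace IsCountSemigroup

variable {κ : ℝ≥0 → Measure ℕ}

/-- `κ (m + h)` is the law of a `κ m` variable plus an independent nonnegative one. -/
theorem cdf_antitone (hκ : IsCountSemigroup κ) (k : ℕ) :
    Antitone fun m => κ m (Set.Iic k) := by
  intro m m' hmm
  obtain ⟨h, rfl⟩ := exists_add_of_le hmm
  have := hκ.prob m
  have := hκ.prob h
  simp only
  rw [hκ.conv, Measure.conv, Measure.map_apply (by fun_prop) (by measurability)]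
  calc (κ m).prod (κ h) ((fun x : ℕ × ℕ => x.1 + x.2) ⁻¹' Set.Iic k)
      ≤ (κ m).prod (κ h) (Set.Iic k ×ˢ Set.univ) := by
        apply measure_mono
        intro x hx
        simp only [Set.mem_preimage, Set.mem_Iic] at hx
        simp only [Set.mem_prod, Set.mem_Iic, Set.mem_univ, and_true]
        lia
    _ = κ m (Set.Iic k) := by simp

/-- The added independent variable matters only when it is at least `1`, which has probability at
most its mean `h` by Markov's inequality. -/
theorem cdf_le_add (hκ : IsCountSemigroup κ) (m h : ℝ≥0) (k : ℕ) :
    κ m (Set.Iic k) ≤ κ (m + h) (Set.Iic k) + h := by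
  have := hκ.prob m
  have := hκ.prob h
  have hpos : κ h (Set.Ici 1) ≤ h := by
    rw [← hκ.mean h]
    have := mul_meas_ge_le_lintegral (μ := κ h) (f := fun k : ℕ => (k : ℝ≥0∞)) .of_discrete 1
    simpa [Set.Ici] using this
  rw [hκ.conv, Measure.conv, Measure.map_apply (by fun_prop) (by measurability)]
  calc κ m (Set.Iic k) = (κ m).prod (κ h) (Set.Iic k ×ˢ Set.univ) := by simp
    _ ≤ (κ m).prod (κ h) ((fun x : ℕ × ℕ => x.1 + x.2) ⁻¹' Set.Iic k ∪ Set.univ ×ˢ Set.Ici 1) := by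
        apply measure_mono
        intro x hx
        simp only [Set.mem_prod, Set.mem_Iic, Set.mem_univ, and_true] at hx
        simp only [Set.mem_union, Set.mem_preimage, Set.mem_Iic, Set.mem_prod, Set.mem_univ,
          Set.mem_Ici, true_and]
        lia
    _ ≤ (κ m).prod (κ h) ((fun x : ℕ × ℕ => x.1 + x.2) ⁻¹' Set.Iic k)
        + (κ m).prod (κ h) (Set.univ ×ˢ Set.Ici 1) := measure_union_le _ _
    _ ≤ _ := by
        gcongr
        simpa using hpos

theorem lipschitz_cdf (hκ : IsCountSemigroup κ) (k : ℕ) :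
    LipschitzWith 1 fun m => (κ m).real (Set.Iic k) := by
  apply LipschitzWith.of_dist_le_mul
  have key : ∀ m h : ℝ≥0, |(κ m).real (Set.Iic k) - (κ (m + h)).real (Set.Iic k)| ≤ h := by
    intro m h
    have := hκ.prob m
    have := hκ.prob (m + h)
    have h1 := ENNReal.toReal_mono (measure_ne_top _ _)
      (hκ.cdf_antitone k (le_self_add : m ≤ m + h))
    have h2 := ENNReal.toReal_mono (ENNReal.add_ne_top.2 ⟨measure_ne_top _ _, ENNReal.coe_ne_top⟩)
      (hκ.cdf_le_add m h k)
    rw [ENNReal.toReal_add (measure_ne_top _ _) ENNReal.coe_ne_top] at h2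
    simp only [measureReal_def, ENNReal.coe_toReal] at *
    rw [abs_of_nonneg (by linarith)]
    linarith
  intro m m'
  rw [NNReal.dist_eq, Real.dist_eq, NNReal.coe_one, one_mul]
  rcases le_total m m' with hmm | hmm <;> obtain ⟨h, rfl⟩ := exists_add_of_le hmm
  · simpa using key m h
  · rw [abs_sub_comm]
    simpa using key m' h

end IsCountSemigroup

/-! ### Compound Poisson laws: a solution forces `Q` onto `ℕ` -/

/-- The `n`-fold convolution power of a measure on the real line. -/
def convPow (Q : Measure ℝ) : ℕ → Measure ℝ
  | 0 => Measure.dirac 0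
  | n + 1 => convPow Q n ∗ Q

instance isProbabilityMeasure_convPow (Q : Measure ℝ) [IsProbabilityMeasure Q] (n : ℕ) :
    IsProbabilityMeasure (convPow Q n) := by
  induction n with
  | zero => unfold convPow; infer_instance
  | succ n ih => unfold convPow; infer_instance

theorem charFun_convPow (Q : Measure ℝ) [IsProbabilityMeasure Q] (n : ℕ) (u : ℝ) :
    charFun (convPow Q n) u = charFun Q u ^ n := by
  induction n with
  | zero => simp [convPow]
  | succ n ih => rw [convPow, charFun_conv, ih, pow_succ]

theorem convPow_compl_range_natCast (Q : Measure ℝ) [IsProbabilityMeasure Q]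
    (hQ : Q (Set.range ((↑) : ℕ → ℝ))ᶜ = 0) (n : ℕ) :
    convPow Q n (Set.range ((↑) : ℕ → ℝ))ᶜ = 0 := by
  have hm : MeasurableSet (Set.range ((↑) : ℕ → ℝ))ᶜ :=
    (MeasurableEmbedding.natCast (α := ℝ)).measurableSet_range.compl
  induction n with
  | zero =>
    rw [convPow, Measure.dirac_apply' _ hm]
    simp
  | succ n ih =>
    rw [convPow, Measure.conv, Measure.map_apply (by fun_prop) hm]
    refine measure_mono_null (t := (Set.range ((↑) : ℕ → ℝ))ᶜ ×ˢ Set.univ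
      ∪ Set.univ ×ˢ (Set.range ((↑) : ℕ → ℝ))ᶜ) ?_ ?_
    · rintro ⟨x, y⟩ h
      by_contra h'
      simp only [Set.mem_union, Set.mem_prod, Set.mem_compl_iff, Set.mem_univ, and_true, true_and,
        not_or, not_not] at h'
      obtain ⟨⟨i, rfl⟩, ⟨j, rfl⟩⟩ := h'
      exact h ⟨i + j, by simp⟩
    · rw [measure_union_null_iff]
      constructor
      · rw [Measure.prod_prod, ih, zero_mul]
      · rw [Measure.prod_prod, hQ, mul_zero]

/-- The law of a random sum of independent variables with law `Q`, the number of summands having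
law `c`. -/
def compoundLaw (c : Measure ℕ) (Q : Measure ℝ) : Measure ℝ :=
  Measure.sum fun n => c {n} • convPow Q n

instance isFiniteMeasure_compoundLaw (c : Measure ℕ) [IsFiniteMeasure c] (Q : Measure ℝ)
    [IsProbabilityMeasure Q] : IsFiniteMeasure (compoundLaw c Q) := by
  constructor
  rw [compoundLaw, Measure.sum_apply _ .univ]
  simp only [Measure.smul_apply, measure_univ, smul_eq_mul, mul_one]
  have := lintegral_countable' (μ := c) 1
  simp only [Pi.one_apply, one_mul, lintegral_one] at this
  rw [← this]
  exact measure_lt_top _ _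

theorem charFun_compoundLaw (c : Measure ℕ) [IsFiniteMeasure c] (Q : Measure ℝ)
    [IsProbabilityMeasure Q] (u : ℝ) :
    charFun (compoundLaw c Q) u = ∫ n, charFun Q u ^ n ∂c := by
  have hint : Integrable (fun x : ℝ => Complex.exp (u * x * Complex.I)) (compoundLaw c Q) := by
    refine Integrable.of_bound (C := 1) (by fun_prop) (.of_forall fun x => ?_)
    rw [← Complex.ofReal_mul, Complex.norm_exp_ofReal_mul_I]
  rw [charFun_apply_real, compoundLaw, integral_sum_measure hint, integral_countable]
  · congr 1 with n
    rw [integral_smul_measure, ← charFun_apply_real, charFun_convPow]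
    rfl
  · refine Integrable.of_bound (C := 1) .of_discrete (.of_forall fun n => ?_)
    rw [norm_pow]
    exact pow_le_one₀ (norm_nonneg _) (norm_charFun_le_one _)

theorem integral_pow_poissonMeasure (r : ℝ≥0) (z : ℂ) :
    ∫ n, z ^ n ∂(poissonMeasure r) = Complex.exp (r * (z - 1)) := by
  rw [integral_poissonMeasure]
  have h1 : ∀ n : ℕ, (Real.exp (-r) * (r : ℝ) ^ n / (n.factorial : ℝ)) • z ^ n
      = Complex.exp (-r) * ((r * z) ^ n / (n.factorial : ℂ)) := by
    intro n
    rw [Complex.real_smul]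
    push_cast
    ring
  simp_rw [h1]
  rw [tsum_mul_left, ← congrFun NormedSpace.exp_eq_tsum_div (r * z : ℂ),
    ← Complex.exp_eq_exp_ℂ, ← Complex.exp_add]
  congr 1
  ring

/-- All convolution powers of `Q` live on `ℕ`, hence so does the compound Poisson law with rate `m /
c`, which can be pulled back to `ℕ`. -/
theorem generatesCounts_of_compl_range (Q : Measure ℝ) [IsProbabilityMeasure Q]
    (hQ : Q (Set.range ((↑) : ℕ → ℝ))ᶜ = 0) {c : ℝ} (hc : 0 < c)
    (hderiv : deriv (charFun Q) 0 = Complex.I * c) : GeneratesCounts (charFun Q) := by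
  intro m hm
  set r : ℝ≥0 := ⟨m / c, by positivity⟩
  have hemb : MeasurableEmbedding ((↑) : ℕ → ℝ) := MeasurableEmbedding.natCast
  set κ : Measure ℕ := (compoundLaw (poissonMeasure r) Q).comap ((↑) : ℕ → ℝ)
  have hmap : κ.map (fun k : ℕ => (k : ℝ)) = compoundLaw (poissonMeasure r) Q := by
    refine (hemb.map_comap _).trans (Measure.restrict_eq_self_of_ae_mem ?_)
    refine (Measure.ae_sum_iff' (p := fun x => x ∈ Set.range ((↑) : ℕ → ℝ))
      hemb.measurableSet_range).2 fun n => ?_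
    exact Measure.ae_smul_measure (convPow_compl_range_natCast Q hQ n) _
  have hcf : ∀ u, charFun (κ.map (fun k : ℕ => (k : ℝ))) u = cpCharFun (charFun Q) m u := by
    intro u
    rw [hmap, charFun_compoundLaw, integral_pow_poissonMeasure, cpCharFun_eq_exp hderiv]
    rfl
  refine ⟨κ, ⟨?_⟩, hcf⟩
  have h0 := hcf 0
  rw [charFun_zero, measureReal_def, Measure.map_apply (by fun_prop) .univ] at h0
  simp only [Set.preimage_univ, cpCharFun, charFun_zero, probReal_univ] at h0
  have : (κ Set.univ).toReal = 1 := by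
    have h2 : (((κ Set.univ).toReal : ℝ) : ℂ) = ((1 : ℝ) : ℂ) := by rw [h0]; simp
    exact_mod_cast h2
  exact (ENNReal.toReal_eq_one_iff _).1 this

/-- If a mixture of compound Poisson laws with jump law `Q` is concentrated on the nonnegative
integers, then so is `Q`. -/
theorem compl_range_of_mixture {Ω : Type*} [MeasurableSpace Ω] (μ : Measure Ω)
    [IsProbabilityMeasure μ] (Q : Measure ℝ) [IsProbabilityMeasure Q] (Λ : Ω → ℝ≥0)
    (hΛ : Measurable Λ) (hpos : ∀ᵐ ω ∂μ, 0 < Λ ω) (W : Ω → ℕ) (hW : Measurable W)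
    (h : ∀ u : ℝ, ∫ ω, Complex.exp (u * W ω * Complex.I) ∂μ
      = ∫ ω, Complex.exp (Λ ω * (charFun Q u - 1)) ∂μ) :
    Q (Set.range ((↑) : ℕ → ℝ))ᶜ = 0 := by
  have hmeas : Measurable fun ω => poissonMeasure (Λ ω) := by
    refine Measure.measurable_of_measurable_coe _ fun s _ => ?_
    simp only [poissonMeasure]
    simp_rw [Measure.sum_apply _ (MeasurableSet.of_discrete (s := s)), Measure.smul_apply]
    refine Measurable.tsum fun n => ?_
    simp only [smul_eq_mul]
    fun_prop
  let K : Kernel Ω ℕ := ⟨fun ω => poissonMeasure (Λ ω), hmeas⟩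
  have : IsMarkovKernel K := ⟨fun ω => inferInstanceAs (IsProbabilityMeasure (poissonMeasure _))⟩
  -- The mixed Poisson law of the number of jumps.
  set c : Measure ℕ := (μ ⊗ₘ K).map Prod.snd with hc
  have : IsProbabilityMeasure c := Measure.isProbabilityMeasure_map (by fun_prop)
  have hlaw : μ.map (fun ω => (W ω : ℝ)) = compoundLaw c Q := by
    have : IsProbabilityMeasure (μ.map (fun ω => (W ω : ℝ))) :=
      Measure.isProbabilityMeasure_map (by fun_prop)
    refine Measure.ext_of_charFun (funext fun u => ?_)
    rw [charFun_compoundLaw, charFun_apply_real, integral_map (by fun_prop) (by fun_prop), hc,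
      integral_map (by fun_prop) .of_discrete, Measure.integral_compProd]
    · simp only [Complex.ofReal_natCast]
      rw [h]
      congr 1 with ω
      exact (integral_pow_poissonMeasure (Λ ω) _).symm
    · refine Integrable.of_bound (C := 1) (by fun_prop) (.of_forall fun n => ?_)
      rw [norm_pow]
      exact pow_le_one₀ (norm_nonneg _) (norm_charFun_le_one _)
  have hm : MeasurableSet (Set.range ((↑) : ℕ → ℝ))ᶜ :=
    (MeasurableEmbedding.natCast (α := ℝ)).measurableSet_range.compl
  have h0 : compoundLaw c Q (Set.range ((↑) : ℕ → ℝ))ᶜ = 0 := by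
    rw [← hlaw, Measure.map_apply (by fun_prop) hm]
    convert measure_empty (μ := μ)
    ext ω
    simp
  rw [compoundLaw, Measure.sum_apply _ hm, ENNReal.tsum_eq_zero] at h0
  -- A vanishing sum of nonnegative terms: the term with exactly one jump is `c {1}` times the mass
  -- of `Q` off `ℕ`. It remains to see that `c {1} ≠ 0`, which holds because `Λ e^{-Λ} > 0` almost
  -- surely.
  have h1 := h0 1
  have hQ1 : convPow Q 1 = Q := by simp [convPow]
  rw [Measure.smul_apply, smul_eq_mul, mul_eq_zero, hQ1] at h1
  refine h1.resolve_left ?_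
  rw [hc, Measure.map_apply (by fun_prop) (by measurability), Measure.compProd_apply
    (by measurability)]
  intro hzero
  rw [lintegral_eq_zero_iff (Kernel.measurable_kernel_prodMk_left (by measurability))] at hzero
  obtain ⟨ω, h2, h3⟩ := (hzero.and hpos).exists
  have h4 : poissonMeasure (Λ ω) {1} = 0 := h2
  rw [poissonMeasure_singleton, ENNReal.ofReal_eq_zero] at h4
  have : 0 < Real.exp (-(Λ ω)) * (Λ ω : ℝ) ^ 1 / (Nat.factorial 1 : ℝ) := by positivity
  linarith

/-- A conditional expectation of unimodular variables has modulus at most `1`; for each `u`, almost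
any value of `M` can serve as the required `m`. -/
theorem exists_deriv_charFun_eq_of_solution {Ω : Type*} (m : MeasurableSpace Ω)
    [mΩ : MeasurableSpace Ω] (μ : Measure Ω) [IsProbabilityMeasure μ] (M : Ω → ℝ)
    (hpos : ∀ᵐ ω ∂μ, 0 < M ω) (Z : Ω → ℕ)
    (Q : Measure ℝ) [IsProbabilityMeasure Q]
    (hdiff : DifferentiableAt ℝ (charFun Q) 0) (hderiv : deriv (charFun Q) 0 ≠ 0)
    (h : ∀ u : ℝ, μ[fun ω => Complex.exp (Complex.I * (u : ℂ) * (Z ω : ℂ)) | m]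
      =ᵐ[μ] fun ω => cpCharFun (charFun Q) (M ω) u) :
    ∃ c : ℝ, 0 < c ∧ deriv (charFun Q) 0 = Complex.I * c := by
  refine exists_deriv_charFun_eq Q hdiff hderiv fun u => ?_
  have h1 := norm_condExp_le (μ := μ) (m := m)
    (fun ω => Complex.exp (Complex.I * (u : ℂ) * (Z ω : ℂ)))
  have h2 : (fun ω => ‖Complex.exp (Complex.I * (u : ℂ) * (Z ω : ℂ))‖) = fun _ => (1 : ℝ) := by
    ext ω
    have : Complex.I * (u : ℂ) * (Z ω : ℂ) = ((u * Z ω : ℝ) : ℂ) * Complex.I := by push_cast; ring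
    rw [this, Complex.norm_exp_ofReal_mul_I]
  rw [h2] at h1
  have h3 : ∀ᵐ ω ∂μ, (μ[fun _ => (1 : ℝ) | m]) ω ≤ 1 := by
    -- Without `m ≤ mΩ` the conditional expectation is `0` by convention, and the bound still holds.
    by_cases hm : m ≤ mΩ
    · simp [condExp_const hm]
    · simp [condExp_of_not_le hm]
  obtain ⟨ω, h4, h5, h6, h7⟩ := (h1.and (h3.and ((h u).and hpos))).exists
  exact ⟨M ω, h7, by simpa only [← h6] using h4.trans h5⟩

/-- Integrating the conditional characteristic function exhibits the law of `Z` as a mixture of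
compound Poisson laws with random rate `M / c`. Thus the assumption of (ii) is automatic in (i). -/
theorem generatesCounts_of_solution {Ω : Type*} (m : MeasurableSpace Ω)
    [mΩ : MeasurableSpace Ω] (μ : Measure Ω) [IsProbabilityMeasure μ] (hm : m ≤ mΩ) (M : Ω → ℝ)
    (hM : Measurable M)
    (hpos : ∀ᵐ ω ∂μ, 0 < M ω) (Z : Ω → ℕ) (hZ : Measurable Z)
    (Q : Measure ℝ) [IsProbabilityMeasure Q]
    (hdiff : DifferentiableAt ℝ (charFun Q) 0) (hderiv : deriv (charFun Q) 0 ≠ 0)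
    (h : ∀ u : ℝ, μ[fun ω => Complex.exp (Complex.I * (u : ℂ) * (Z ω : ℂ)) | m]
      =ᵐ[μ] fun ω => cpCharFun (charFun Q) (M ω) u) :
    GeneratesCounts (charFun Q) := by
  obtain ⟨c, hc, hd⟩ := exists_deriv_charFun_eq_of_solution m μ M hpos Z Q hdiff hderiv h
  refine generatesCounts_of_compl_range Q ?_ hc hd
  refine compl_range_of_mixture μ Q (fun ω => (M ω / c).toNNReal) (by fun_prop) ?_ Z hZ fun u => ?_
  · filter_upwards [hpos] with ω hω
    rw [Real.toNNReal_pos]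
    positivity
  · have h1 : (fun ω => Complex.exp (u * Z ω * Complex.I))
        = fun ω => Complex.exp (Complex.I * (u : ℂ) * (Z ω : ℂ)) := by
      ext ω; congr 1; ring
    rw [h1, ← integral_condExp hm, integral_congr_ae (h u)]
    apply integral_congr_ae
    filter_upwards [hpos] with ω hω
    rw [cpCharFun_eq_exp hd, Real.coe_toNNReal _ (by positivity)]

/-! ### The quantile coupling -/

/-- The quantile function of `κ m`, set to `0` from `1` on. -/
def quantile (κ : ℝ≥0 → Measure ℕ) (m : ℝ≥0) (u : ℝ) : ℕ :=
  if u < 1 then sInf {k | u ≤ (κ m).real (Set.Iic k)} else 0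

/-- The uniform distribution on the unit interval. -/
def unif : Measure ℝ := volume.restrict (Set.Ioo 0 1)

instance : IsProbabilityMeasure unif := ⟨by simp [unif]⟩

namespace IsCountSemigroup

variable {κ : ℝ≥0 → Measure ℕ}

theorem tendsto_cdf (hκ : IsCountSemigroup κ) (m : ℝ≥0) :
    Filter.Tendsto (fun k => (κ m).real (Set.Iic k)) Filter.atTop (nhds 1) := by
  have := hκ.prob m
  have hmono : Monotone fun K : ℕ => Set.Iic K := fun i j hij => Set.Iic_subset_Iic.2 hij
  have h := tendsto_measure_iUnion_atTop (μ := κ m) hmono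
  have hU : (⋃ K : ℕ, Set.Iic K) = Set.univ := by
    ext k; simp
  rw [hU, measure_univ] at h
  exact (ENNReal.tendsto_toReal ENNReal.one_ne_top).comp h

theorem cdf_mono (hκ : IsCountSemigroup κ) (m : ℝ≥0) {k l : ℕ} (h : k ≤ l) :
    (κ m).real (Set.Iic k) ≤ (κ m).real (Set.Iic l) := by
  have := hκ.prob m
  exact measureReal_mono (Set.Iic_subset_Iic.2 h)

theorem quantile_le_iff (hκ : IsCountSemigroup κ) (m : ℝ≥0) {u : ℝ} (hu : u < 1) (k : ℕ) :
    quantile κ m u ≤ k ↔ u ≤ (κ m).real (Set.Iic k) := by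
  rw [quantile, if_pos hu]
  constructor
  · intro h
    have hne : {k | u ≤ (κ m).real (Set.Iic k)}.Nonempty := by
      obtain ⟨k, hk⟩ := ((hκ.tendsto_cdf m).eventually (lt_mem_nhds hu)).exists
      exact ⟨k, hk.le⟩
    exact (Nat.sInf_mem hne : u ≤ _).trans (hκ.cdf_mono m h)
  · intro h
    exact Nat.sInf_le h

theorem measurable_quantile (hκ : IsCountSemigroup κ) :
    Measurable fun x : ℝ≥0 × ℝ => quantile κ x.1 x.2 := by
  refine measurable_of_Iic fun k => ?_
  have h : (fun x : ℝ≥0 × ℝ => quantile κ x.1 x.2) ⁻¹' Set.Iic k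
      = {x | 1 ≤ x.2} ∪ {x | x.2 ≤ (κ x.1).real (Set.Iic k)} ∩ {x | x.2 < 1} := by
    ext x
    by_cases hx : x.2 < 1
    · simp [hκ.quantile_le_iff x.1 hx, hx, not_le.2 hx]
    · simp [quantile, hx, not_lt.1 hx]
  rw [h]
  have hc : Measurable fun x : ℝ≥0 × ℝ => (κ x.1).real (Set.Iic k) :=
    (hκ.lipschitz_cdf k).continuous.measurable.comp measurable_fst
  exact (measurableSet_le measurable_const measurable_snd).union
    ((measurableSet_le measurable_snd hc).inter (measurableSet_lt measurable_snd measurable_const))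

theorem quantile_mono (hκ : IsCountSemigroup κ) (u : ℝ) : Monotone fun m => quantile κ m u := by
  intro m m' hmm
  by_cases hu : u < 1
  · have := hκ.prob m
    rw [hκ.quantile_le_iff m hu]
    refine ((hκ.quantile_le_iff m' hu _).1 le_rfl).trans ?_
    exact ENNReal.toReal_mono (measure_ne_top _ _) (hκ.cdf_antitone _ hmm)
  · simp [quantile, hu]

/-- Left-continuity in `m`. The distribution function of `κ m` just below the quantile is strictly
less than `u`; by continuity in `m` this persists for `s n`, so the quantile cannot drop, while
monotonicity keeps it from exceeding its limit. -/
theorem eventually_quantile_eq (hκ : IsCountSemigroup κ) (u : ℝ) {s : ℕ → ℝ≥0} {m : ℝ≥0}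
    (hle : ∀ n, s n ≤ m) (hs : Filter.Tendsto s Filter.atTop (nhds m)) :
    ∀ᶠ n in Filter.atTop, quantile κ (s n) u = quantile κ m u := by
  by_cases hu : u < 1
  · rcases Nat.eq_zero_or_pos (quantile κ m u) with h0 | hpos
    · refine .of_forall fun n => ?_
      have := hκ.quantile_mono u (hle n)
      simp only at this
      lia
    · have h1 : (κ m).real (Set.Iic (quantile κ m u - 1)) < u := by
        rw [← not_le, ← hκ.quantile_le_iff m hu]
        lia
      have h2 := ((hκ.lipschitz_cdf (quantile κ m u - 1)).continuous.tendsto m).comp hs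
      filter_upwards [h2.eventually (gt_mem_nhds h1)] with n hn
      have h3 := hκ.quantile_mono u (hle n)
      have h4 : ¬ quantile κ (s n) u ≤ quantile κ m u - 1 := by
        rw [hκ.quantile_le_iff _ hu]
        exact not_le.2 hn
      simp only at h3
      lia
  · simp [quantile, hu]

theorem map_quantile (hκ : IsCountSemigroup κ) (m : ℝ≥0) : unif.map (quantile κ m) = κ m := by
  have := hκ.prob m
  have hmeas : Measurable (quantile κ m) := hκ.measurable_quantile.comp measurable_prodMk_left
  have : IsProbabilityMeasure (unif.map (quantile κ m)) :=
    Measure.isProbabilityMeasure_map hmeas.aemeasurable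
  refine Measure.ext_of_Iic _ _ fun k => ?_
  rw [Measure.map_apply hmeas measurableSet_Iic, unif,
    Measure.restrict_apply (hmeas measurableSet_Iic)]
  have h1 : (κ m).real (Set.Iic k) ≤ 1 := measureReal_le_one
  have h : quantile κ m ⁻¹' Set.Iic k ∩ Set.Ioo 0 1
      = Set.Ioc 0 ((κ m).real (Set.Iic k)) ∩ Set.Iio 1 := by
    ext u
    simp only [Set.mem_inter_iff, Set.mem_preimage, Set.mem_Iic, Set.mem_Ioo, Set.mem_Ioc,
      Set.mem_Iio]
    constructor
    · rintro ⟨h2, h3, h4⟩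
      exact ⟨⟨h3, (hκ.quantile_le_iff m h4 k).1 h2⟩, h4⟩
    · rintro ⟨⟨h2, h3⟩, h4⟩
      exact ⟨(hκ.quantile_le_iff m h4 k).2 h3, h2, h4⟩
  -- If the distribution function reaches `1` at `k`, the point `u = 1` is lost; it is a null set.
  have hae : (Set.Ioc 0 ((κ m).real (Set.Iic k)) ∩ Set.Iio 1 : Set ℝ)
      =ᵐ[volume] (Set.Ioc 0 ((κ m).real (Set.Iic k)) ∩ Set.Iic 1 : Set ℝ) :=
    (Filter.EventuallyEq.refl _ _).inter Iio_ae_eq_Iic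
  rw [h, measure_congr hae, Set.inter_eq_left.2 (fun u hu => hu.2.trans h1), Real.volume_Ioc,
    sub_zero, ofReal_measureReal]

theorem lintegral_quantile (hκ : IsCountSemigroup κ) (m : ℝ≥0) :
    ∫⁻ u, (quantile κ m u : ℝ≥0∞) ∂unif = m := by
  have hmeas : Measurable (quantile κ m) := hκ.measurable_quantile.comp measurable_prodMk_left
  have h := lintegral_map (μ := unif) (f := fun k : ℕ => (k : ℝ≥0∞)) .of_discrete hmeas
  rw [hκ.map_quantile, hκ.mean] at h
  exact h.symm

end IsCountSemigroup

/-! ### Innovations and the compounding operator -/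

/-- The innovations at one time: the number of summands and uniform variables generating the
counting series. -/
abbrev Innov : Type := ℕ × (ℕ → ℝ)

/-- The law of the innovations at one time. -/
def innovLaw (ρ : Measure ℕ) : Measure Innov := ρ.prod (Measure.infinitePi fun _ : ℕ => unif)

instance (ρ : Measure ℕ) [IsProbabilityMeasure ρ] : IsProbabilityMeasure (innovLaw ρ) := by
  unfold innovLaw; infer_instance

/-- The compounding operator driven by the innovations. -/
def compound (κ : ℝ≥0 → Measure ℕ) (m : ℝ≥0) (e : Innov) : ℕ :=
  ∑ j ∈ Finset.range e.1, quantile κ m (e.2 j)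

namespace IsCountSemigroup

variable {κ : ℝ≥0 → Measure ℕ}

theorem measurable_compound (hκ : IsCountSemigroup κ) :
    Measurable fun x : ℝ≥0 × Innov => compound κ x.1 x.2 := by
  have h : Measurable fun y : ℕ × (ℝ≥0 × Innov) =>
      ∑ j ∈ Finset.range y.1, quantile κ y.2.1 (y.2.2.2 j) := by
    refine measurable_from_prod_countable_right fun n => ?_
    change Measurable fun x : ℝ≥0 × Innov => ∑ j ∈ Finset.range n, quantile κ x.1 (x.2.2 j)
    refine Finset.measurable_fun_sum _ fun j _ => ?_
    exact hκ.measurable_quantile.comp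
      (by fun_prop : Measurable fun x : ℝ≥0 × Innov => (x.1, x.2.2 j))
  exact h.comp (by fun_prop : Measurable fun x : ℝ≥0 × Innov => (x.2.1, x))

theorem compound_mono (hκ : IsCountSemigroup κ) (e : Innov) :
    Monotone fun m => compound κ m e := fun _ _ hmm =>
  Finset.sum_le_sum fun _ _ => hκ.quantile_mono _ hmm

theorem eventually_compound_eq (hκ : IsCountSemigroup κ) (e : Innov) {s : ℕ → ℝ≥0} {m : ℝ≥0}
    (hle : ∀ n, s n ≤ m) (hs : Filter.Tendsto s Filter.atTop (nhds m)) :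
    ∀ᶠ n in Filter.atTop, compound κ (s n) e = compound κ m e := by
  have h : ∀ᶠ n in Filter.atTop, ∀ j ∈ Finset.range e.1,
      quantile κ (s n) (e.2 j) = quantile κ m (e.2 j) :=
    (Filter.eventually_all_finset _).2 fun j _ => hκ.eventually_quantile_eq _ hle hs
  filter_upwards [h] with n hn
  exact Finset.sum_congr rfl hn

/-- Wald's identity: the number of summands has mean one and is independent of the uniform
variables. -/
theorem lintegral_compound (hκ : IsCountSemigroup κ) {ρ : Measure ℕ} [IsProbabilityMeasure ρ]
    (hρ : ∫⁻ k, (k : ℝ≥0∞) ∂ρ = 1) (m : ℝ≥0) :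
    ∫⁻ e, (compound κ m e : ℝ≥0∞) ∂(innovLaw ρ) = m := by
  have hmeas : Measurable (quantile κ m) := hκ.measurable_quantile.comp measurable_prodMk_left
  have hc : Measurable (compound κ m) := hκ.measurable_compound.comp measurable_prodMk_left
  have hj : ∀ j : ℕ, ∫⁻ u : ℕ → ℝ, (quantile κ m (u j) : ℝ≥0∞)
      ∂(Measure.infinitePi fun _ : ℕ => unif) = m := by
    intro j
    have h := lintegral_map (μ := Measure.infinitePi fun _ : ℕ => unif) (g := fun u => u j)
      (f := fun u : ℝ => (quantile κ m u : ℝ≥0∞)) (by fun_prop) (by fun_prop)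
    rw [Measure.infinitePi_map_eval, hκ.lintegral_quantile] at h
    exact h.symm
  rw [innovLaw, lintegral_prod _ (by fun_prop)]
  simp only [compound, Nat.cast_sum]
  calc ∫⁻ n, ∫⁻ u : ℕ → ℝ, ∑ j ∈ Finset.range n, (quantile κ m (u j) : ℝ≥0∞)
        ∂(Measure.infinitePi fun _ : ℕ => unif) ∂ρ
      = ∫⁻ n, (n : ℝ≥0∞) * m ∂ρ := by
        refine lintegral_congr fun n => ?_
        rw [lintegral_finsetSum _ (fun j _ => by fun_prop)]
        simp [hj]
    _ = m := by rw [lintegral_mul_const _ .of_discrete, hρ, one_mul]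

/-- With common innovations the two counts are ordered like `m` and `m'`, so the mean absolute
difference is the difference of the means. Compounding therefore neither expands nor contracts, and
only the recursion coefficients matter. -/
theorem lintegral_enorm_compound_sub (hκ : IsCountSemigroup κ) {ρ : Measure ℕ}
    [IsProbabilityMeasure ρ] (hρ : ∫⁻ k, (k : ℝ≥0∞) ∂ρ = 1) (m m' : ℝ≥0) :
    ∫⁻ e, ‖(compound κ m e : ℝ) - compound κ m' e‖ₑ ∂(innovLaw ρ) = ‖(m : ℝ) - m'‖ₑ := by
  wlog hmm : m' ≤ m generalizing m m'
  · rw [← enorm_neg, neg_sub, ← this m' m (le_of_not_ge hmm)]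
    refine lintegral_congr fun e => ?_
    rw [← enorm_neg, neg_sub]
  have hc : ∀ m, Measurable (compound κ m) := fun m => hκ.measurable_compound.comp measurable_prodMk_left
  have h1 : ∀ x y : ℝ≥0, y ≤ x → ‖(x : ℝ) - y‖ₑ = (x : ℝ≥0∞) - y := by
    intro x y hxy
    rw [← NNReal.coe_sub hxy, ← ENNReal.coe_sub]
    simp
  have h2 : ∀ e, ‖(compound κ m e : ℝ) - compound κ m' e‖ₑ
      = (compound κ m e : ℝ≥0∞) - compound κ m' e := by
    intro e
    have := h1 (compound κ m e) (compound κ m' e) (by exact_mod_cast hκ.compound_mono e hmm)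
    simpa using this
  simp_rw [h2]
  rw [lintegral_sub (by fun_prop) (by rw [hκ.lintegral_compound hρ]; exact ENNReal.coe_ne_top)
    (.of_forall fun e => by
      have := hκ.compound_mono e hmm
      exact_mod_cast this),
    hκ.lintegral_compound hρ, hκ.lintegral_compound hρ, h1 _ _ hmm]

end IsCountSemigroup

/-! ### Conditioning with independent variables -/

theorem map_restrict_prodMk_of_indep {Ω β γ : Type*} {m m' : MeasurableSpace Ω}
    [mΩ : MeasurableSpace Ω] [MeasurableSpace β] [MeasurableSpace γ] {μ : Measure Ω}
    [IsProbabilityMeasure μ] (hm : m ≤ mΩ) (hm' : m' ≤ mΩ) (hind : Indep m m' μ)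
    {W : Ω → β} (hW : Measurable[m] W) {V : Ω → γ} (hV : Measurable[m'] V)
    {B : Set Ω} (hB : MeasurableSet[m] B) :
    (μ.restrict B).map (fun ω => (W ω, V ω)) = ((μ.restrict B).map W).prod (μ.map V) := by
  have hW' : Measurable W := hW.mono hm le_rfl
  have hV' : Measurable V := hV.mono hm' le_rfl
  symm
  refine Measure.prod_eq fun S T hS hT => ?_
  rw [Measure.map_apply (hW'.prodMk hV') (hS.prod hT), Measure.map_apply hW' hS,
    Measure.map_apply hV' hT, Measure.restrict_apply (hW'.prodMk hV' (hS.prod hT)),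
    Measure.restrict_apply (hW' hS)]
  have h := (Indep_iff _ _ μ).1 hind (W ⁻¹' S ∩ B) (V ⁻¹' T) ((hW hS).inter hB) (hV hT)
  rw [← h]
  congr 1
  ext ω
  simp only [Set.mem_inter_iff, Set.mem_preimage, Set.mem_prod]
  tauto

/-- Freezing the known variable: on each event `B` of `m` the joint law of `W` and `V` is a product,
so Fubini's theorem computes the integral over `B`. -/
theorem condExp_of_indep {Ω β γ E : Type*} {m m' : MeasurableSpace Ω}
    [mΩ : MeasurableSpace Ω] [MeasurableSpace β] [MeasurableSpace γ] {μ : Measure Ω}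
    [NormedAddCommGroup E] [NormedSpace ℝ E] [CompleteSpace E]
    [IsProbabilityMeasure μ] (hm : m ≤ mΩ) (hm' : m' ≤ mΩ) (hind : Indep m m' μ)
    {W : Ω → β} (hW : Measurable[m] W) {V : Ω → γ} (hV : Measurable[m'] V)
    {f : β × γ → E} (hf : StronglyMeasurable f) (hint : Integrable (fun ω => f (W ω, V ω)) μ) :
    μ[fun ω => f (W ω, V ω) | m] =ᵐ[μ] fun ω => ∫ v, f (W ω, v) ∂(μ.map V) := by
  have hW' : Measurable W := hW.mono hm le_rfl
  have hV' : Measurable V := hV.mono hm' le_rfl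
  have : IsProbabilityMeasure (μ.map V) := Measure.isProbabilityMeasure_map hV'.aemeasurable
  have hlaw := fun B hB => map_restrict_prodMk_of_indep (μ := μ) (B := B) hm hm' hind hW hV hB
  have hsm : StronglyMeasurable fun w => ∫ v, f (w, v) ∂(μ.map V) := hf.integral_prod_right'
  have hint' : ∀ B, MeasurableSet[m] B →
      Integrable f (((μ.restrict B).map W).prod (μ.map V)) := by
    intro B hB
    rw [← hlaw B hB, integrable_map_measure hf.aestronglyMeasurable
      (hW'.prodMk hV').aemeasurable]
    exact hint.restrict
  symm
  refine ae_eq_condExp_of_forall_setIntegral_eq hm hint (fun B hB _ => ?_) (fun B hB _ => ?_) ?_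
  · exact (integrable_map_measure hsm.aestronglyMeasurable hW'.aemeasurable).1
      (hint' B hB).integral_prod_left
  · calc ∫ ω in B, ∫ v, f (W ω, v) ∂(μ.map V) ∂μ
        = ∫ w, ∫ v, f (w, v) ∂(μ.map V) ∂((μ.restrict B).map W) :=
          (integral_map hW'.aemeasurable hsm.aestronglyMeasurable).symm
      _ = ∫ x, f x ∂(((μ.restrict B).map W).prod (μ.map V)) := (integral_prod _ (hint' B hB)).symm
      _ = ∫ ω in B, f (W ω, V ω) ∂μ := by
          rw [← hlaw B hB, integral_map (hW'.prodMk hV').aemeasurable hf.aestronglyMeasurable]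
  · exact (hsm.comp_measurable hW).aestronglyMeasurable

/-- It suffices to test intersections of an event of `m` with one of `b`, which form a π-system
generating `m ⊔ b`; there the probabilities factor by the two assumed independences. -/
theorem indep_sup_of_indep {Ω : Type*} {m a b e : MeasurableSpace Ω} [mΩ : MeasurableSpace Ω]
    {μ : Measure Ω} [IsProbabilityMeasure μ] (hm : m ≤ mΩ) (he : e ≤ mΩ) (hae : a ≤ e) (hbe : b ≤ e)
    (hme : Indep m e μ) (hab : Indep a b μ) : Indep a (m ⊔ b) μ := by
  have hgen : m ⊔ b = MeasurableSpace.generateFrom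
      (Set.image2 (· ∩ ·) {s | MeasurableSet[m] s} {s | MeasurableSet[b] s}) := by
    apply le_antisymm
    · refine sup_le (fun s hs => ?_) (fun s hs => ?_)
      · exact MeasurableSpace.measurableSet_generateFrom ⟨s, hs, Set.univ, .univ, by simp⟩
      · exact MeasurableSpace.measurableSet_generateFrom ⟨Set.univ, .univ, s, hs, by simp⟩
    · refine MeasurableSpace.generateFrom_le ?_
      rintro _ ⟨s, hs, t, ht, rfl⟩
      exact MeasurableSet.inter ((le_sup_left : m ≤ m ⊔ b) s hs) ((le_sup_right : b ≤ m ⊔ b) t ht)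
  refine IndepSets.indep (hae.trans he) (sup_le hm (hbe.trans he))
    (@MeasurableSpace.isPiSystem_measurableSet Ω a) ?_
    (@MeasurableSpace.generateFrom_measurableSet Ω a).symm hgen ?_
  · rintro _ ⟨s, hs, t, ht, rfl⟩ _ ⟨s', hs', t', ht', rfl⟩ _
    refine ⟨s ∩ s', MeasurableSet.inter hs hs', t ∩ t', MeasurableSet.inter ht ht', ?_⟩
    simp only
    rw [Set.inter_inter_inter_comm]
  · rw [IndepSets_iff]
    rintro r _ hr ⟨s, hs, t, ht, rfl⟩
    have h1 := (Indep_iff _ _ μ).1 hme s (r ∩ t) hs (MeasurableSet.inter (hae r hr) (hbe t ht))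
    have h2 := (Indep_iff _ _ μ).1 hab r t hr ht
    have h3 := (Indep_iff _ _ μ).1 hme s t hs (hbe t ht)
    simp only
    rw [h3, Set.inter_left_comm, h1, h2]
    ring

/-! ### Ergodicity of the Bernoulli shift -/

/-- The left shift on sequences indexed by the integers. -/
def shiftSeq {E : Type*} (x : ℤ → E) : ℤ → E := fun t => x (t + 1)

theorem shiftSeq_iterate {E : Type*} (n : ℕ) (x : ℤ → E) (t : ℤ) : shiftSeq^[n] x t = x (t + n) := by
  induction n generalizing t with
  | zero => simp
  | succ n ih =>
    rw [Function.iterate_succ_apply', shiftSeq, ih]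
    congr 1
    push_cast
    ring

section Bernoulli

variable {E : Type*} [MeasurableSpace E] (ν : Measure E) [IsProbabilityMeasure ν]

theorem measurePreserving_shiftSeq :
    MeasurePreserving (shiftSeq (E := E)) (Measure.infinitePi fun _ : ℤ => ν)
      (Measure.infinitePi fun _ : ℤ => ν) :=
  ⟨by unfold shiftSeq; fun_prop,
    Measure.map_infinitePi_infinitePi_of_inj (P := fun _ : ℤ => ν) (add_left_injective (1 : ℤ))⟩

theorem indep_iSup_eval {S T : Set ℤ} (hST : Disjoint S T) :
    Indep (⨆ s ∈ S, MeasurableSpace.comap (fun x : ℤ → E => x s) inferInstance)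
      (⨆ s ∈ T, MeasurableSpace.comap (fun x : ℤ → E => x s) inferInstance)
      (Measure.infinitePi fun _ : ℤ => ν) := by
  have h : iIndepFun (fun (s : ℤ) (x : ℤ → E) => x s) (Measure.infinitePi fun _ : ℤ => ν) :=
    iIndepFun_infinitePi (P := fun _ : ℤ => ν) (X := fun _ x => x) (fun _ => measurable_id)
  exact indep_iSup_of_disjoint (fun s => (measurable_pi_apply s).comap_le) h hST

/-- The two-sided shift on an i.i.d. sequence is ergodic. -/
theorem ergodic_shiftSeq :
    Ergodic (shiftSeq (E := E)) (Measure.infinitePi fun _ : ℤ => ν) := by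
  set P := Measure.infinitePi fun _ : ℤ => ν with hP
  have hmp : MeasurePreserving (shiftSeq (E := E)) P P := measurePreserving_shiftSeq ν
  refine ⟨hmp, ⟨fun {A} hA hinv => ?_⟩⟩
  -- Approximate the invariant event `A` by a cylinder `B`. A translate `B'` of `B` on disjoint
  -- coordinates is independent of `B` and approximates `A` equally well, so `P A` is close to `(P
  -- A)²`.
  have hkey : ∀ δ : ℝ, 0 < δ → |P.real A - P.real A * P.real A| ≤ 4 * δ := by
    intro δ hδ
    obtain ⟨B, hB, hBA⟩ := exists_measure_symmDiff_lt_of_generateFrom_isSetRing (μ := P)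
      isSetRing_measurableCylinders
      ⟨{Set.univ}, Set.countable_singleton _,
        Set.singleton_subset_iff.2 (univ_mem_measurableCylinders fun _ : ℤ => E), by simp⟩
      generateFrom_measurableCylinders.symm hA (ENNReal.ofReal_pos.2 hδ)
    rw [mem_measurableCylinders] at hB
    obtain ⟨F, S, hS, rfl⟩ := hB
    have hBm : MeasurableSet (cylinder (α := fun _ : ℤ => E) F S) := MeasurableSet.cylinder (α := fun _ : ℤ => E) F hS
    set B := cylinder (α := fun _ : ℤ => E) F S with hBdef
    obtain ⟨N, hN⟩ : ∃ N : ℕ, ∀ s ∈ F, ∀ t ∈ F, s ≠ t + N := by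
      obtain ⟨K, hK⟩ := (F.finite_toSet.image fun s => |s|).bddAbove
      -- Two points of `F` differ by at most `2 K`, with `K` a bound on their absolute values.
      refine ⟨(2 * K + 1).toNat, fun s hs t ht h => ?_⟩
      have h1 := hK ⟨s, hs, rfl⟩
      have h2 := hK ⟨t, ht, rfl⟩
      simp only at h1 h2
      have h3 := abs_le.1 h1
      have h4 := abs_le.1 h2
      have h5 := abs_nonneg s
      rw [Int.toNat_of_nonneg (by linarith)] at h
      lia
    have hmpN := hmp.iterate N
    set B' := (shiftSeq^[N]) ⁻¹' B with hB'def
    have hB'm : MeasurableSet B' := hmpN.measurable hBm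
    have hcyl : ∀ (T : Set ℤ) (g : (ℤ → E) → (F → E)),
        (∀ s : F, ∃ t ∈ T, (fun x => g x s) = fun x => x t) →
        MeasurableSet[⨆ s ∈ T, MeasurableSpace.comap (fun x : ℤ → E => x s) inferInstance]
          (g ⁻¹' S) := by
      intro T g hg
      refine (@measurable_pi_iff _ _ _ (_) _ g).2 (fun s => ?_) hS
      obtain ⟨t, ht, htg⟩ := hg s
      rw [htg]
      exact Measurable.mono (comap_measurable _)
        (le_iSup₂ (f := fun s (_ : s ∈ T) =>
          MeasurableSpace.comap (fun x : ℤ → E => x s) inferInstance) t ht) le_rfl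
    have hind : P (B ∩ B') = P B * P B' := by
      have hdisj : Disjoint (F : Set ℤ) ((fun s => s + (N : ℤ)) '' (F : Set ℤ)) := by
        rw [Set.disjoint_left]
        rintro s hs ⟨t, ht, hst⟩
        exact hN s hs t ht hst.symm
      refine (Indep_iff _ _ P).1 (indep_iSup_eval ν hdisj) B B' ?_ ?_
      · exact hcyl _ F.restrict fun s => ⟨s, s.2, rfl⟩
      · refine hcyl _ (fun x => F.restrict (shiftSeq^[N] x)) fun s => ⟨s + N, ⟨s, s.2, rfl⟩, ?_⟩
        ext x
        exact shiftSeq_iterate N x s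
    have hPB' : P B' = P B := hmpN.measure_preimage hBm.nullMeasurableSet
    have hAinv : (shiftSeq^[N]) ⁻¹' A = A := by
      clear * - hinv
      induction N with
      | zero => rfl
      | succ n ih => rw [Function.iterate_succ', Set.preimage_comp, hinv, ih]
    have hd : P.real (symmDiff B A) ≤ δ :=
      ENNReal.toReal_le_of_le_ofReal hδ.le hBA.le
    have hd' : P.real (symmDiff B' A) ≤ δ := by
      have : symmDiff B' A = (shiftSeq^[N]) ⁻¹' (symmDiff B A) := by
        rw [Set.preimage_symmDiff, hAinv]
      rw [this, measureReal_def,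
        hmpN.measure_preimage (hBm.symmDiff hA).nullMeasurableSet]
      exact hd
    have h1 : |P.real B - P.real A| ≤ δ :=
      (abs_measureReal_sub_le_measureReal_symmDiff hBm.nullMeasurableSet
        hA.nullMeasurableSet).trans hd
    have h2 : |P.real (B ∩ B') - P.real A| ≤ 2 * δ := by
      refine (abs_measureReal_sub_le_measureReal_symmDiff (hBm.inter hB'm).nullMeasurableSet
        hA.nullMeasurableSet).trans ?_
      calc P.real (symmDiff (B ∩ B') A) ≤ P.real (symmDiff B A ∪ symmDiff B' A) := by
            refine measureReal_mono ?_ (measure_ne_top _ _)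
            intro x
            simp only [Set.mem_symmDiff, Set.mem_inter_iff, Set.mem_union]
            tauto
        _ ≤ P.real (symmDiff B A) + P.real (symmDiff B' A) := measureReal_union_le _ _
        _ ≤ 2 * δ := by linarith
    have h3 : P.real (B ∩ B') = P.real B * P.real B := by
      simp only [measureReal_def, hind, hPB', ENNReal.toReal_mul]
    rw [h3] at h2
    have h4 : P.real B ≤ 1 := measureReal_le_one
    have h5 : P.real A ≤ 1 := measureReal_le_one
    have h6 : 0 ≤ P.real B := measureReal_nonneg
    have h7 : 0 ≤ P.real A := measureReal_nonneg
    rw [abs_le] at h1 h2 ⊢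
    constructor <;> nlinarith
  have h0 : P.real A - P.real A * P.real A = 0 := by
    by_contra hne
    have := hkey (|P.real A - P.real A * P.real A| / 8) (by positivity)
    have h2 := abs_pos.2 hne
    linarith
  have h1 : P.real A = 0 ∨ P.real A = 1 := by
    have : P.real A * (1 - P.real A) = 0 := by linarith
    rcases mul_eq_zero.1 this with h | h
    · exact .inl h
    · exact .inr (by linarith)
  rw [Filter.eventuallyConst_set']
  rcases h1 with h | h
  · left
    rw [ae_eq_empty]
    exact (measureReal_eq_zero_iff).1 h
  · right
    rw [ae_eq_univ, prob_compl_eq_zero_iff hA]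
    rw [measureReal_def] at h
    exact (ENNReal.toReal_eq_one_iff _).1 h

end Bernoulli

/-! ### The linear recursion for the means -/

section Recursion

variable {p q : ℕ}

/-- The linear recursion for the conditional means. -/
def meanRec (a₀ : ℝ≥0) (a : Fin p → ℝ≥0) (b : Fin q → ℝ≥0) (x : ℤ → ℕ) (m : ℤ → ℝ≥0) (t : ℤ) :
    ℝ≥0 :=
  a₀ + ∑ i : Fin p, a i * (x (t - 1 - (i : ℤ)) : ℝ≥0) + ∑ j : Fin q, b j * m (t - 1 - (j : ℤ))

variable {a₀ : ℝ≥0} {a : Fin p → ℝ≥0} {b : Fin q → ℝ≥0}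

theorem measurable_meanRec {Ω : Type*} {mΩ : MeasurableSpace Ω} {x : Ω → ℤ → ℕ} {m : Ω → ℤ → ℝ≥0}
    {t : ℤ} (hx : ∀ s < t, Measurable fun ω => x ω s) (hm : ∀ s < t, Measurable fun ω => m ω s) :
    Measurable fun ω => meanRec a₀ a b (x ω) (m ω) t := by
  unfold meanRec
  have h1 : ∀ i : Fin p, Measurable fun ω => x ω (t - 1 - (i : ℤ)) := fun i => hx _ (by lia)
  have h2 : ∀ i : Fin q, Measurable fun ω => m ω (t - 1 - (i : ℤ)) := fun i => hm _ (by lia)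
  fun_prop

theorem meanRec_mono {x x' : ℤ → ℕ} {m m' : ℤ → ℝ≥0} (hx : ∀ s, x s ≤ x' s)
    (hm : ∀ s, m s ≤ m' s) (t : ℤ) : meanRec a₀ a b x m t ≤ meanRec a₀ a b x' m' t := by
  unfold meanRec
  gcongr with i _ j _
  · exact_mod_cast hx _
  · exact hm _

theorem meanRec_congr {x x' : ℤ → ℕ} {m m' : ℤ → ℝ≥0} {t : ℤ} (hx : ∀ s < t, x s = x' s)
    (hm : ∀ s < t, m s = m' s) : meanRec a₀ a b x m t = meanRec a₀ a b x' m' t := by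
  unfold meanRec
  congr 1
  · congr 1
    exact Finset.sum_congr rfl fun i _ => by rw [hx _ (by lia)]
  · exact Finset.sum_congr rfl fun i _ => by rw [hm _ (by lia)]

theorem le_meanRec (x : ℤ → ℕ) (m : ℤ → ℝ≥0) (t : ℤ) : a₀ ≤ meanRec a₀ a b x m t := by
  unfold meanRec
  rw [add_assoc]
  exact le_self_add

theorem lintegral_meanRec_le {Ω : Type*} [MeasurableSpace Ω] {μ : Measure Ω}
    [IsProbabilityMeasure μ] {x : Ω → ℤ → ℕ} {m : Ω → ℤ → ℝ≥0}
    (hx : ∀ s, Measurable fun ω => x ω s) (hm : ∀ s, Measurable fun ω => m ω s) {C : ℝ≥0∞}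
    (hxC : ∀ s, ∫⁻ ω, x ω s ∂μ ≤ C) (hmC : ∀ s, ∫⁻ ω, m ω s ∂μ ≤ C) (t : ℤ) :
    ∫⁻ ω, meanRec a₀ a b (x ω) (m ω) t ∂μ ≤ a₀ + (∑ i, a i + ∑ j, b j : ℝ≥0) * C := by
  unfold meanRec
  push_cast
  rw [lintegral_add_left (by fun_prop), lintegral_add_left (by fun_prop),
    lintegral_finsetSum _ (fun i _ => by fun_prop), lintegral_finsetSum _ (fun i _ => by fun_prop),
    lintegral_const, measure_univ, mul_one, add_assoc, add_mul, Finset.sum_mul, Finset.sum_mul]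
  gcongr with i _ j _
  · rw [lintegral_const_mul _ (by fun_prop)]
    gcongr
    exact hxC _
  · rw [lintegral_const_mul _ (by fun_prop)]
    gcongr
    exact hmC _

end Recursion

/-- The sigma-field generated by the coordinates before time `t`. -/
@[reducible] def coordsBefore (E : Type*) [MeasurableSpace E] (t : ℤ) : MeasurableSpace (ℤ → E) :=
  ⨆ s ∈ Set.Iio t, MeasurableSpace.comap (fun x : ℤ → E => x s) inferInstance

section CoordsBefore

variable {E : Type*} [MeasurableSpace E]

theorem coordsBefore_le (t : ℤ) : coordsBefore E t ≤ (inferInstance : MeasurableSpace (ℤ → E)) :=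
  iSup₂_le fun s _ => (measurable_pi_apply s).comap_le

theorem coordsBefore_mono {s t : ℤ} (h : s ≤ t) : coordsBefore E s ≤ coordsBefore E t :=
  biSup_mono fun _ hr => lt_of_lt_of_le hr h

theorem measurable_coordsBefore {s t : ℤ} (h : s < t) :
    Measurable[coordsBefore E t] fun x : ℤ → E => x s :=
  Measurable.mono (comap_measurable _)
    (le_iSup₂ (f := fun s (_ : s ∈ Set.Iio t) =>
      MeasurableSpace.comap (fun x : ℤ → E => x s) inferInstance) s h) le_rfl

theorem indep_coordsBefore (ν : Measure E) [IsProbabilityMeasure ν] (t : ℤ) :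
    Indep (coordsBefore E t) (MeasurableSpace.comap (fun x : ℤ → E => x t) inferInstance)
      (Measure.infinitePi fun _ : ℤ => ν) := by
  have h := indep_iSup_eval ν (S := Set.Iio t) (T := {t}) (by simp)
  rwa [iSup_singleton] at h

end CoordsBefore

/-! ### Picard iteration driven by the innovations -/

section Solution

variable {p q : ℕ} (a₀ : ℝ≥0) (a : Fin p → ℝ≥0) (b : Fin q → ℝ≥0) (κ : ℝ≥0 → Measure ℕ)

/-- The Picard iterates of the conditional means, started from zero. -/
def iterMean : ℕ → (ℤ → Innov) → ℤ → ℝ≥0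
  | 0 => fun _ _ => 0
  | n + 1 => fun e =>
      meanRec a₀ a b (fun s => compound κ (iterMean n e s) (e s)) (iterMean n e)

/-- The limit of the Picard iterates. -/
def solMean (e : ℤ → Innov) (t : ℤ) : ℝ≥0 :=
  (⨆ n, (iterMean a₀ a b κ n e t : ℝ≥0∞)).toNNReal

/-- The counts of the limit of the Picard iterates. -/
def solCount (e : ℤ → Innov) (t : ℤ) : ℕ := compound κ (solMean a₀ a b κ e t) (e t)

/-- The counting series of the limit of the Picard iterates. -/
def solSeries (e : ℤ → Innov) (t : ℤ) (j : ℕ) : ℕ :=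
  quantile κ (solMean a₀ a b κ e t) ((e t).2 j)

/-- The law of the innovations at all times. -/
def noise (ρ : Measure ℕ) : Measure (ℤ → Innov) := Measure.infinitePi fun _ : ℤ => innovLaw ρ

instance (ρ : Measure ℕ) [IsProbabilityMeasure ρ] : IsProbabilityMeasure (noise ρ) := by
  unfold noise; infer_instance

variable {a₀ a b κ}

/-- The same formula is used at every time. This equivariance passes to the limit and yields
stationarity and ergodicity. -/
theorem iterMean_shiftSeq (n : ℕ) (e : ℤ → Innov) (t : ℤ) :
    iterMean a₀ a b κ n (shiftSeq e) t = iterMean a₀ a b κ n e (t + 1) := by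
  induction n generalizing t with
  | zero => rfl
  | succ n ih =>
    simp only [iterMean, meanRec, ih]
    simp only [shiftSeq]
    have h : ∀ i : ℤ, t - 1 - i + 1 = t + 1 - 1 - i := fun i => by ring
    simp only [h]

theorem solMean_shiftSeq (e : ℤ → Innov) (t : ℤ) :
    solMean a₀ a b κ (shiftSeq e) t = solMean a₀ a b κ e (t + 1) := by
  simp only [solMean, iterMean_shiftSeq]

theorem solCount_shiftSeq (e : ℤ → Innov) (t : ℤ) :
    solCount a₀ a b κ (shiftSeq e) t = solCount a₀ a b κ e (t + 1) := by
  simp only [solCount, solMean_shiftSeq]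
  rfl

variable (hκ : IsCountSemigroup κ)
include hκ

/-- Both the recursion and compounding are monotone, and the iteration starts at the least element.
-/
theorem iterMean_mono (e : ℤ → Innov) (t : ℤ) :
    Monotone fun n => iterMean a₀ a b κ n e t := by
  refine monotone_nat_of_le_succ fun n => ?_
  induction n generalizing t with
  | zero => simp [iterMean]
  | succ n ih =>
    exact meanRec_mono (fun s => hκ.compound_mono _ (ih s)) ih t

/-- Predictability: only counts strictly before `t` enter, so the mean at time `t` is independent of
the innovation at time `t`. -/
theorem measurable_iterMean (n : ℕ) (t : ℤ) :
    Measurable[coordsBefore Innov t] fun e => iterMean a₀ a b κ n e t := by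
  induction n generalizing t with
  | zero => exact measurable_const
  | succ n ih =>
    refine measurable_meanRec (mΩ := coordsBefore Innov t)
      (x := fun e s => compound κ (iterMean a₀ a b κ n e s) (e s))
      (m := fun e => iterMean a₀ a b κ n e) (fun s hs => ?_) fun s hs => ?_
    · exact hκ.measurable_compound.comp
        (Measurable.prodMk ((ih s).mono (coordsBefore_mono hs.le) le_rfl)
          (measurable_coordsBefore hs))
    · exact (ih s).mono (coordsBefore_mono hs.le) le_rfl

theorem measurable_solMean (t : ℤ) :
    Measurable[coordsBefore Innov t] fun e => solMean a₀ a b κ e t := by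
  refine Measurable.ennreal_toNNReal ?_
  exact Measurable.iSup fun n => (measurable_iterMean hκ n t).coe_nnreal_ennreal

theorem measurable_solCount {s t : ℤ} (h : s < t) :
    Measurable[coordsBefore Innov t] fun e => solCount a₀ a b κ e s :=
  hκ.measurable_compound.comp
    (Measurable.prodMk ((measurable_solMean hκ s).mono (coordsBefore_mono h.le) le_rfl)
      (measurable_coordsBefore h))

theorem measurable_solMean' (t : ℤ) : Measurable fun e => solMean a₀ a b κ e t :=
  (measurable_solMean hκ t).mono (coordsBefore_le t) le_rfl

theorem measurable_solCount' (t : ℤ) : Measurable fun e => solCount a₀ a b κ e t :=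
  (measurable_solCount hκ (lt_add_one t)).mono (coordsBefore_le _) le_rfl

theorem measurable_solSeries (t : ℤ) (j : ℕ) : Measurable fun e => solSeries a₀ a b κ e t j :=
  hκ.measurable_quantile.comp (Measurable.prodMk (measurable_solMean' hκ t)
    (by fun_prop : Measurable fun e : ℤ → Innov => (e t).2 j))

variable {ρ : Measure ℕ} [IsProbabilityMeasure ρ]

omit hκ in
theorem map_eval_noise (t : ℤ) : (noise ρ).map (fun e => e t) = innovLaw ρ :=
  Measure.infinitePi_map_eval (fun _ : ℤ => innovLaw ρ) t

omit hκ in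
theorem lintegral_noise {β : Type*} [MeasurableSpace β] {t : ℤ} {W : (ℤ → Innov) → β}
    (hW : Measurable[coordsBefore Innov t] W) {f : β × Innov → ℝ≥0∞} (hf : Measurable f) :
    ∫⁻ e, f (W e, e t) ∂(noise ρ) = ∫⁻ e, ∫⁻ i, f (W e, i) ∂(innovLaw ρ) ∂(noise ρ) := by
  have hlaw := map_restrict_prodMk_of_indep (coordsBefore_le (E := Innov) t)
    (measurable_pi_apply t).comap_le (indep_coordsBefore (innovLaw ρ) t) hW
    (comap_measurable (fun e : ℤ → Innov => e t)) (B := Set.univ) .univ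
  rw [Measure.restrict_univ] at hlaw
  change (noise ρ).map _ = ((noise ρ).map _).prod ((noise ρ).map _) at hlaw
  have hW' : Measurable W := hW.mono (coordsBefore_le t) le_rfl
  rw [← lintegral_map (μ := noise ρ) (g := fun e => (W e, e t)) hf (by fun_prop), hlaw,
    map_eval_noise, lintegral_prod _ hf.aemeasurable,
    lintegral_map hf.lintegral_prod_right' hW']

theorem lintegral_compound_noise (hρ : ∫⁻ k, (k : ℝ≥0∞) ∂ρ = 1) {t : ℤ} {W : (ℤ → Innov) → ℝ≥0}
    (hW : Measurable[coordsBefore Innov t] W) :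
    ∫⁻ e, (compound κ (W e) (e t) : ℝ≥0∞) ∂(noise ρ) = ∫⁻ e, W e ∂(noise ρ) := by
  have hc := hκ.measurable_compound
  rw [lintegral_noise hW (f := fun x : ℝ≥0 × Innov => (compound κ x.1 x.2 : ℝ≥0∞)) (by fun_prop)]
  simp only [hκ.lintegral_compound hρ]

variable {C : ℝ≥0} (hC : a₀ + (∑ i, a i + ∑ j, b j) * C ≤ C)
include hC

/-- Compounding preserves expectations, so `hC` says that the bound `C` survives one application of
the recursion. -/
theorem lintegral_iterMean_le (hρ : ∫⁻ k, (k : ℝ≥0∞) ∂ρ = 1) (n : ℕ) (t : ℤ) :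
    ∫⁻ e, (iterMean a₀ a b κ n e t : ℝ≥0∞) ∂(noise ρ) ≤ C := by
  induction n generalizing t with
  | zero => simp [iterMean]
  | succ n ih =>
    have hm : ∀ s, Measurable fun e => iterMean a₀ a b κ n e s := fun s =>
      (measurable_iterMean hκ n s).mono (coordsBefore_le s) le_rfl
    refine (lintegral_meanRec_le (x := fun e s => compound κ (iterMean a₀ a b κ n e s) (e s))
      (m := fun e => iterMean a₀ a b κ n e) (fun s => ?_) hm (fun s => ?_) ih t).trans ?_
    · exact hκ.measurable_compound.comp (Measurable.prodMk (hm s) (measurable_pi_apply s))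
    · exact (lintegral_compound_noise hκ hρ (measurable_iterMean hκ n s)).trans_le (ih s)
    · exact_mod_cast hC

theorem lintegral_iSup_iterMean_le (hρ : ∫⁻ k, (k : ℝ≥0∞) ∂ρ = 1) (t : ℤ) :
    ∫⁻ e, ⨆ n, (iterMean a₀ a b κ n e t : ℝ≥0∞) ∂(noise ρ) ≤ C := by
  rw [lintegral_iSup (fun n => ((measurable_iterMean hκ n t).mono (coordsBefore_le t)
    le_rfl).coe_nnreal_ennreal) (fun i j hij e =>
      ENNReal.coe_le_coe.2 (iterMean_mono hκ e t hij))]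
  exact iSup_le fun n => lintegral_iterMean_le hκ hC hρ n t

theorem ae_iSup_iterMean_lt_top (hρ : ∫⁻ k, (k : ℝ≥0∞) ∂ρ = 1) :
    ∀ᵐ e ∂(noise ρ), ∀ t, ⨆ n, (iterMean a₀ a b κ n e t : ℝ≥0∞) < ∞ := by
  rw [ae_all_iff]
  intro t
  refine ae_lt_top ?_ ((lintegral_iSup_iterMean_le hκ hC hρ t).trans_lt ENNReal.coe_lt_top).ne
  exact Measurable.iSup fun n => ((measurable_iterMean hκ n t).mono (coordsBefore_le t)
    le_rfl).coe_nnreal_ennreal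

theorem lintegral_solMean_le (hρ : ∫⁻ k, (k : ℝ≥0∞) ∂ρ = 1) (t : ℤ) :
    ∫⁻ e, (solMean a₀ a b κ e t : ℝ≥0∞) ∂(noise ρ) ≤ C :=
  (lintegral_mono fun _ => ENNReal.coe_toNNReal_le_self).trans
    (lintegral_iSup_iterMean_le hκ hC hρ t)

theorem lintegral_solCount_le (hρ : ∫⁻ k, (k : ℝ≥0∞) ∂ρ = 1) (t : ℤ) :
    ∫⁻ e, (solCount a₀ a b κ e t : ℝ≥0∞) ∂(noise ρ) ≤ C :=
  (lintegral_compound_noise hκ hρ (measurable_solMean hκ t)).trans_le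
    (lintegral_solMean_le hκ hC hρ t)

/-- Since the means increase to their limit, left-continuity makes each count constant after
finitely many iterations. Both sides of the recursion can then pass to the limit. -/
theorem ae_solMean_eq (hρ : ∫⁻ k, (k : ℝ≥0∞) ∂ρ = 1) :
    ∀ᵐ e ∂(noise ρ), ∀ t, solMean a₀ a b κ e t
      = meanRec a₀ a b (solCount a₀ a b κ e) (solMean a₀ a b κ e) t := by
  -- Off this null event the supremum may be infinite, where `toNNReal` returns `0`.
  filter_upwards [ae_iSup_iterMean_lt_top hκ hC hρ] with e he t
  have hsup : ∀ s, ((solMean a₀ a b κ e s : ℝ≥0) : ℝ≥0∞) = ⨆ n, (iterMean a₀ a b κ n e s : ℝ≥0∞) :=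
    fun s => ENNReal.coe_toNNReal (he s).ne
  have hle : ∀ s n, iterMean a₀ a b κ n e s ≤ solMean a₀ a b κ e s := by
    intro s n
    rw [← ENNReal.coe_le_coe, hsup]
    exact le_iSup (fun n => (iterMean a₀ a b κ n e s : ℝ≥0∞)) n
  have hlim : ∀ s, Filter.Tendsto (fun n => iterMean a₀ a b κ n e s) Filter.atTop
      (nhds (solMean a₀ a b κ e s)) := by
    intro s
    rw [← ENNReal.tendsto_coe, hsup]
    exact tendsto_atTop_iSup fun i j hij => ENNReal.coe_le_coe.2 (iterMean_mono hκ e s hij)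
  have hx : ∀ s, Filter.Tendsto (fun n => (compound κ (iterMean a₀ a b κ n e s) (e s) : ℝ≥0))
      Filter.atTop (nhds (solCount a₀ a b κ e s : ℝ≥0)) := by
    intro s
    refine tendsto_const_nhds.congr' ?_
    filter_upwards [hκ.eventually_compound_eq (e s) (hle s) (hlim s)] with n hn
    rw [hn, solCount]
  refine tendsto_nhds_unique ((hlim t).comp (Filter.tendsto_add_atTop_nat 1)) ?_
  change Filter.Tendsto (fun n => meanRec a₀ a b
    (fun s => compound κ (iterMean a₀ a b κ n e s) (e s)) (iterMean a₀ a b κ n e) t) _ _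
  unfold meanRec
  refine (tendsto_const_nhds.add (tendsto_finsetSum _ fun i _ => ?_)).add
    (tendsto_finsetSum _ fun j _ => ?_)
  · exact tendsto_const_nhds.mul (hx _)
  · exact tendsto_const_nhds.mul (hlim _)

end Solution

theorem measurable_shift : Measurable shift := by
  unfold shift; fun_prop

theorem map_snd_innovLaw (ρ : Measure ℕ) [IsProbabilityMeasure ρ] :
    (innovLaw ρ).map Prod.snd = Measure.infinitePi fun _ : ℕ => unif := by
  rw [innovLaw, ← Measure.snd, Measure.snd_prod]

theorem map_fst_innovLaw (ρ : Measure ℕ) [IsProbabilityMeasure ρ] :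
    (innovLaw ρ).map Prod.fst = ρ := by
  rw [innovLaw, ← Measure.fst, Measure.fst_prod]

theorem indepFun_fst_snd_noise (ρ : Measure ℕ) [IsProbabilityMeasure ρ] (t : ℤ) :
    IndepFun (fun e : ℤ → Innov => (e t).1) (fun e => (e t).2) (noise ρ) := by
  have h1 := Measure.map_map (μ := noise ρ) (g := Prod.fst) (f := fun e : ℤ → Innov => e t)
    (by fun_prop) (by fun_prop)
  have h2 := Measure.map_map (μ := noise ρ) (g := Prod.snd) (f := fun e : ℤ → Innov => e t)
    (by fun_prop) (by fun_prop)
  rw [map_eval_noise, map_fst_innovLaw] at h1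
  rw [map_eval_noise, map_snd_innovLaw] at h2
  rw [indepFun_iff_map_prod_eq_prod_map_map (Measurable.aemeasurable (by fun_prop))
    (Measurable.aemeasurable (by fun_prop))]
  change (noise ρ).map (fun e => e t) = ((noise ρ).map (Prod.fst ∘ fun e : ℤ → Innov => e t)).prod
    ((noise ρ).map (Prod.snd ∘ fun e : ℤ → Innov => e t))
  rw [← h1, ← h2, map_eval_noise, innovLaw]

theorem map_coord_innovLaw (ρ : Measure ℕ) [IsProbabilityMeasure ρ] (j : ℕ) :
    (innovLaw ρ).map (fun i => i.2 j) = unif := by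
  rw [← Measure.infinitePi_map_eval (fun _ : ℕ => unif) j, ← map_snd_innovLaw ρ,
    Measure.map_map (by fun_prop) (by fun_prop)]
  rfl

theorem IsCountSemigroup.innovLaw_quantile {κ : ℝ≥0 → Measure ℕ} (hκ : IsCountSemigroup κ)
    (ρ : Measure ℕ) [IsProbabilityMeasure ρ] (m : ℝ≥0) (s : Finset ℕ) (A : ℕ → Set ℕ) :
    (innovLaw ρ).real {i | ∀ j ∈ s, quantile κ m (i.2 j) ∈ A j}
      = ∏ j ∈ s, (κ m).real (A j) := by
  have hmeas : Measurable (quantile κ m) := hκ.measurable_quantile.comp measurable_prodMk_left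
  have h1 : {i : Innov | ∀ j ∈ s, quantile κ m (i.2 j) ∈ A j}
      = Prod.snd ⁻¹' ((s : Set ℕ).pi fun j => quantile κ m ⁻¹' A j) := by
    ext i; simp
  have hm : MeasurableSet ((s : Set ℕ).pi fun j => quantile κ m ⁻¹' A j) :=
    MeasurableSet.pi s.countable_toSet fun j _ => hmeas .of_discrete
  rw [h1, measureReal_def, ← Measure.map_apply measurable_snd hm, map_snd_innovLaw,
    Measure.infinitePi_pi _ (fun j _ => hmeas .of_discrete), ENNReal.toReal_prod]
  refine Finset.prod_congr rfl fun j _ => ?_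
  rw [← Measure.map_apply hmeas .of_discrete, hκ.map_quantile, measureReal_def]

/-! ### The limit is a compounding CMEM -/

section Solution

variable {p q : ℕ} {a₀ : ℝ≥0} {a : Fin p → ℝ≥0} {b : Fin q → ℝ≥0} {κ : ℝ≥0 → Measure ℕ}
  (hκ : IsCountSemigroup κ)
include hκ

/-- The past of the limit of the Picard iterates. -/
abbrev solPast (a₀ : ℝ≥0) (a : Fin p → ℝ≥0) (b : Fin q → ℝ≥0) (κ : ℝ≥0 → Measure ℕ) (t : ℤ) :
    MeasurableSpace (ℤ → Innov) :=
  past (fun t e => solCount a₀ a b κ e t) (fun t e => (solMean a₀ a b κ e t : ℝ)) t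

theorem solPast_le (t : ℤ) : solPast a₀ a b κ t ≤ coordsBefore Innov t := by
  refine iSup_le fun s => ?_
  refine Measurable.comap_le (Measurable.prodMk (measurable_solCount hκ s.2) ?_)
  exact ((measurable_solMean hκ (s : ℤ)).mono (coordsBefore_mono s.2.le) le_rfl).coe_nnreal_real

theorem solPast_le' (t : ℤ) :
    solPast a₀ a b κ t ≤ (inferInstance : MeasurableSpace (ℤ → Innov)) :=
  (solPast_le hκ t).trans (coordsBefore_le t)

omit hκ in
theorem measurable_past {Ω : Type*} (X : ℤ → Ω → ℕ) (M : ℤ → Ω → ℝ) {s t : ℤ} (h : s < t) :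
    Measurable[past X M t] fun ω => (X s ω, M s ω) :=
  Measurable.mono (comap_measurable _)
    (le_iSup (fun s : {s : ℤ // s < t} =>
      MeasurableSpace.comap (fun ω => (X s ω, M s ω)) inferInstance) ⟨s, h⟩) le_rfl

omit hκ in
theorem measurable_past_meanRec {Ω : Type*} (X : ℤ → Ω → ℕ) (M : ℤ → Ω → ℝ) (t : ℤ) :
    Measurable[past X M t] fun ω =>
      meanRec a₀ a b (fun s => X s ω) (fun s => (M s ω).toNNReal) t := by
  refine measurable_meanRec (mΩ := past X M t) (x := fun ω s => X s ω)
    (m := fun ω s => (M s ω).toNNReal) (fun s hs => ?_) fun s hs => ?_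
  · exact measurable_fst.comp (measurable_past X M hs)
  · exact (measurable_snd.comp (measurable_past X M hs)).real_toNNReal

variable {ρ : Measure ℕ} [IsProbabilityMeasure ρ]
  {C : ℝ≥0} (hC : a₀ + (∑ i, a i + ∑ j, b j) * C ≤ C) (hρ : ∫⁻ k, (k : ℝ≥0∞) ∂ρ = 1)
include hC hρ

/-- The sigma-field `solPast` is not completed, and `solMean` at time `t` need not be measurable for
it. It is replaced by the almost surely equal `W`, computed by the recursion from the past, before
freezing. -/
theorem condExp_solPast {E : Type*} [NormedAddCommGroup E] [NormedSpace ℝ E] [CompleteSpace E]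
    (t : ℤ) {f : ℝ≥0 × Innov → E} (hf : StronglyMeasurable f)
    (hint : Integrable (fun e => f (solMean a₀ a b κ e t, e t)) (noise ρ)) :
    (noise ρ)[fun e => f (solMean a₀ a b κ e t, e t) | solPast a₀ a b κ t]
      =ᵐ[noise ρ] fun e => ∫ i, f (solMean a₀ a b κ e t, i) ∂(innovLaw ρ) := by
  set W : (ℤ → Innov) → ℝ≥0 :=
    fun e => meanRec a₀ a b (solCount a₀ a b κ e) (solMean a₀ a b κ e) t with hWdef
  have hW : Measurable[solPast a₀ a b κ t] W := by
    have := measurable_past_meanRec (a₀ := a₀) (a := a) (b := b)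
      (fun t e => solCount a₀ a b κ e t) (fun t e => (solMean a₀ a b κ e t : ℝ)) t
    simpa only [Real.toNNReal_coe] using this
  have hWae : ∀ᵐ e ∂(noise ρ), solMean a₀ a b κ e t = W e :=
    (ae_solMean_eq hκ hC hρ).mono fun e he => he t
  have h1 : (fun e => f (solMean a₀ a b κ e t, e t)) =ᵐ[noise ρ] fun e => f (W e, e t) :=
    hWae.mono fun e he => by simp only [he]
  have h2 := condExp_of_indep (μ := noise ρ) (m := solPast a₀ a b κ t) (solPast_le' hκ t)
    (measurable_pi_apply t).comap_le
    (indep_of_indep_of_le_left (indep_coordsBefore (innovLaw ρ) t) (solPast_le hκ t)) hW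
    (comap_measurable (fun e : ℤ → Innov => e t)) hf (hint.congr h1)
  refine (condExp_congr_ae h1).trans (h2.trans ?_)
  filter_upwards [hWae] with e he
  rw [map_eval_noise, he]

theorem condProb_solSeries (t : ℤ) (s : Finset ℕ) (A : ℕ → Set ℕ) :
    (noise ρ)⟦⋂ j ∈ s, (fun e => solSeries a₀ a b κ e t j) ⁻¹' A j | solPast a₀ a b κ t⟧
      =ᵐ[noise ρ] fun e => ∏ j ∈ s, (κ (solMean a₀ a b κ e t)).real (A j) := by
  set S : Set (ℝ≥0 × Innov) := {x | ∀ j ∈ s, quantile κ x.1 (x.2.2 j) ∈ A j} with hS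
  have hSm : MeasurableSet S := by
    have : S = ⋂ j ∈ s, (fun x : ℝ≥0 × Innov => quantile κ x.1 (x.2.2 j)) ⁻¹' A j := by
      ext x; simp [hS]
    rw [this]
    refine Finset.measurableSet_biInter _ fun j _ => ?_
    exact (hκ.measurable_quantile.comp
      (by fun_prop : Measurable fun x : ℝ≥0 × Innov => (x.1, x.2.2 j))) .of_discrete
  have hf : StronglyMeasurable (S.indicator fun _ => (1 : ℝ)) :=
    stronglyMeasurable_const.indicator hSm
  have h1 : (fun e => S.indicator (fun _ => (1 : ℝ)) (solMean a₀ a b κ e t, e t))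
      = (⋂ j ∈ s, (fun e => solSeries a₀ a b κ e t j) ⁻¹' A j).indicator fun _ => (1 : ℝ) := by
    classical
    ext e
    rw [Set.indicator_apply, Set.indicator_apply]
    congr 1
    simp [hS, solSeries]
  have hpair : Measurable fun e : ℤ → Innov => (solMean a₀ a b κ e t, e t) :=
    (measurable_solMean' hκ t).prodMk (measurable_pi_apply t)
  have hint : Integrable (fun e => S.indicator (fun _ => (1 : ℝ)) (solMean a₀ a b κ e t, e t))
      (noise ρ) := by
    refine Integrable.of_bound (C := 1) (hf.comp_measurable hpair).aestronglyMeasurable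
      (.of_forall fun e => ?_)
    exact norm_indicator_le_norm_self (fun _ => (1 : ℝ)) _ |>.trans (by simp)
  have h2 := condExp_solPast hκ hC hρ t hf hint
  rw [h1] at h2
  refine h2.trans (.of_forall fun e => ?_)
  simp only
  rw [← hκ.innovLaw_quantile ρ, ← integral_indicator_one (by
    exact measurable_prodMk_left (x := solMean a₀ a b κ e t) hSm)]
  rfl

theorem condProb_solSeries_single (t : ℤ) (j : ℕ) (A : Set ℕ) :
    (noise ρ)⟦(fun e => solSeries a₀ a b κ e t j) ⁻¹' A | solPast a₀ a b κ t⟧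
      =ᵐ[noise ρ] fun e => (κ (solMean a₀ a b κ e t)).real A := by
  simpa using condProb_solSeries hκ hC hρ t {j} (fun _ => A)

theorem integrable_solSeries (t : ℤ) (j : ℕ) :
    Integrable (fun e => (solSeries a₀ a b κ e t j : ℝ)) (noise ρ) := by
  have hZ := measurable_solSeries (a₀ := a₀) (a := a) (b := b) hκ t j
  refine ⟨(by fun_prop), ?_⟩
  have hf : Measurable fun x : ℝ≥0 × Innov => (quantile κ x.1 (x.2.2 j) : ℝ≥0∞) := by
    have := hκ.measurable_quantile.comp
      (by fun_prop : Measurable fun x : ℝ≥0 × Innov => (x.1, x.2.2 j))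
    exact measurable_from_top.comp this
  have h := lintegral_noise (ρ := ρ) (measurable_solMean (a₀ := a₀) (a := a) (b := b) hκ t) hf
  have h2 : ∀ m, ∫⁻ i : Innov, (quantile κ m (i.2 j) : ℝ≥0∞) ∂(innovLaw ρ) = m := by
    intro m
    have hm : Measurable (quantile κ m) := hκ.measurable_quantile.comp measurable_prodMk_left
    have h3 := lintegral_map (μ := innovLaw ρ) (g := fun i => i.2 j)
      (f := fun u : ℝ => (quantile κ m u : ℝ≥0∞)) (by fun_prop) (by fun_prop)
    rw [map_coord_innovLaw, hκ.lintegral_quantile] at h3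
    exact h3.symm
  simp only [h2] at h
  rw [hasFiniteIntegral_iff_enorm]
  calc ∫⁻ e, ‖(solSeries a₀ a b κ e t j : ℝ)‖ₑ ∂(noise ρ)
      = ∫⁻ e, (quantile κ (solMean a₀ a b κ e t) ((e t).2 j) : ℝ≥0∞) ∂(noise ρ) := by
        refine lintegral_congr fun e => ?_
        simp [solSeries]
    _ ≤ C := h.trans_le (lintegral_solMean_le hκ hC hρ t)
    _ < ∞ := ENNReal.coe_lt_top

theorem condMean_solSeries (t : ℤ) (j : ℕ) :
    (noise ρ)[fun e => (solSeries a₀ a b κ e t j : ℝ) | solPast a₀ a b κ t]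
      =ᵐ[noise ρ] fun e => (solMean a₀ a b κ e t : ℝ) := by
  have hq : Measurable fun x : ℝ≥0 × Innov => quantile κ x.1 (x.2.2 j) :=
    hκ.measurable_quantile.comp (by fun_prop : Measurable fun x : ℝ≥0 × Innov => (x.1, x.2.2 j))
  refine (condExp_solPast hκ hC hρ t (f := fun x => (quantile κ x.1 (x.2.2 j) : ℝ))
    (Measurable.stronglyMeasurable (by fun_prop))
    (integrable_solSeries hκ hC hρ t j)).trans (.of_forall fun e => ?_)
  set m := solMean a₀ a b κ e t
  have hm : Measurable (quantile κ m) := hκ.measurable_quantile.comp measurable_prodMk_left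
  simp only
  have h1 := integral_map (μ := innovLaw ρ) (φ := fun i => i.2 j)
    (f := fun u : ℝ => (quantile κ m u : ℝ)) (by fun_prop)
    (Measurable.aestronglyMeasurable (by fun_prop))
  rw [map_coord_innovLaw] at h1
  rw [← h1, integral_eq_lintegral_of_nonneg_ae (.of_forall fun u => by positivity)
    (Measurable.aestronglyMeasurable (by fun_prop))]
  simp only [ENNReal.ofReal_natCast]
  rw [hκ.lintegral_quantile, ENNReal.coe_toReal]

theorem condCharFun_solSeries {φ : ℝ → ℂ}
    (hφ : ∀ (m : ℝ≥0) u, charFun ((κ m).map (fun k : ℕ => (k : ℝ))) u = cpCharFun φ m u)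
    (t : ℤ) (j : ℕ) (u : ℝ) :
    (noise ρ)[fun e => Complex.exp (Complex.I * (u : ℂ) * (solSeries a₀ a b κ e t j : ℂ))
      | solPast a₀ a b κ t] =ᵐ[noise ρ] fun e => cpCharFun φ (solMean a₀ a b κ e t) u := by
  have hq : Measurable fun x : ℝ≥0 × Innov => quantile κ x.1 (x.2.2 j) :=
    hκ.measurable_quantile.comp (by fun_prop : Measurable fun x : ℝ≥0 × Innov => (x.1, x.2.2 j))
  have hexp : ∀ k : ℕ, Complex.exp (Complex.I * (u : ℂ) * (k : ℂ))
      = Complex.exp (((u * k : ℝ) : ℂ) * Complex.I) := by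
    intro k
    congr 1
    push_cast
    ring
  have hZ := measurable_solSeries (a₀ := a₀) (a := a) (b := b) hκ t j
  refine (condExp_solPast hκ hC hρ t
    (f := fun x => Complex.exp (Complex.I * (u : ℂ) * (quantile κ x.1 (x.2.2 j) : ℂ)))
    (Measurable.stronglyMeasurable (by fun_prop)) ?_).trans (.of_forall fun e => ?_)
  · refine Integrable.of_bound (C := 1) ?_ (.of_forall fun e => ?_)
    · apply Measurable.aestronglyMeasurable
      change Measurable fun e =>
        Complex.exp (Complex.I * (u : ℂ) * (solSeries a₀ a b κ e t j : ℂ))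
      fun_prop
    · rw [hexp, Complex.norm_exp_ofReal_mul_I]
  set m := solMean a₀ a b κ e t
  have hm : Measurable (quantile κ m) := hκ.measurable_quantile.comp measurable_prodMk_left
  simp only
  have h1 := integral_map (μ := innovLaw ρ) (φ := fun i => i.2 j)
    (f := fun v : ℝ => Complex.exp (Complex.I * (u : ℂ) * (quantile κ m v : ℂ))) (by fun_prop)
    (Measurable.aestronglyMeasurable (by fun_prop))
  have h2 := integral_map (μ := unif) (φ := quantile κ m)
    (f := fun k : ℕ => Complex.exp (Complex.I * (u : ℂ) * (k : ℂ))) hm.aemeasurable .of_discrete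
  rw [map_coord_innovLaw] at h1
  rw [hκ.map_quantile] at h2
  rw [← h1, ← h2, ← hφ, charFun_map_natCast]
  congr 1 with k
  congr 1
  ring

theorem isCompoundingCMEM_sol (ha₀ : 0 < a₀) :
    IsCompoundingCMEM (noise ρ) (a₀ : ℝ) (fun i => (a i : ℝ)) (fun j => (b j : ℝ)) ρ
      (fun t e => solCount a₀ a b κ e t) (fun t e => (solMean a₀ a b κ e t : ℝ))
      (fun t e => (e t).1) (fun t j e => solSeries a₀ a b κ e t j) where
  measurable_X := measurable_solCount' hκ
  measurable_M t := (measurable_solMean' hκ t).coe_nnreal_real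
  measurable_ε t := by fun_prop
  measurable_Z := measurable_solSeries hκ
  M_pos t := by
    filter_upwards [ae_solMean_eq hκ hC hρ] with e he
    rw [he t]
    exact_mod_cast ha₀.trans_le (le_meanRec _ _ _)
  M_rec t := by
    filter_upwards [ae_solMean_eq hκ hC hρ] with e he
    rw [he t]
    simp [meanRec]
  X_eq t := .of_forall fun e => rfl
  ε_indep := iIndepFun_infinitePi (P := fun _ : ℤ => innovLaw ρ) (X := fun _ i => i.1)
    (fun _ => measurable_fst)
  ε_law t := by
    have h := Measure.map_map (μ := noise ρ) (g := Prod.fst) (f := fun e : ℤ → Innov => e t)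
      (by fun_prop) (by fun_prop)
    rw [map_eval_noise, map_fst_innovLaw] at h
    exact h.symm
  ε_indep_past t := by
    -- The number of summands is independent of the uniform variables at time `t`, and both are
    -- jointly independent of earlier innovations. The counting series depends only on those and on
    -- the uniform variables at `t`.
    have hsup := indep_sup_of_indep (μ := noise ρ) (m := coordsBefore Innov t)
      (a := MeasurableSpace.comap (fun e : ℤ → Innov => (e t).1) inferInstance)
      (b := MeasurableSpace.comap (fun e : ℤ → Innov => (e t).2) inferInstance)
      (coordsBefore_le t) (measurable_pi_apply t).comap_le
      (measurable_fst.comp (comap_measurable fun e : ℤ → Innov => e t)).comap_le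
      (measurable_snd.comp (comap_measurable fun e : ℤ → Innov => e t)).comap_le
      (indep_coordsBefore (innovLaw ρ) t) (indepFun_fst_snd_noise ρ t)
    refine indep_of_indep_of_le_right hsup (sup_le ((solPast_le hκ t).trans le_sup_left)
      (iSup_le fun j => Measurable.comap_le ?_))
    refine hκ.measurable_quantile.comp (Measurable.prodMk ?_ ?_)
    · exact (measurable_solMean hκ t).mono le_sup_left le_rfl
    · exact ((measurable_pi_apply j).comp
        (comap_measurable fun e : ℤ → Innov => (e t).2)).mono le_sup_right le_rfl
  Z_condIndep t := by
    intro s A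
    refine (condProb_solSeries hκ hC hρ t s A).trans ?_
    have h : ∀ᵐ e ∂(noise ρ), ∀ j ∈ s, ((noise ρ)⟦(fun e => solSeries a₀ a b κ e t j) ⁻¹' A j |
        solPast a₀ a b κ t⟧) e = (κ (solMean a₀ a b κ e t)).real (A j) :=
      (Filter.eventually_all_finset s).2 fun j _ => condProb_solSeries_single hκ hC hρ t j (A j)
    filter_upwards [h] with e he
    rw [Finset.prod_apply]
    exact Finset.prod_congr rfl fun j hj => (he j hj).symm
  Z_condIdent t j A := (condProb_solSeries_single hκ hC hρ t j A).trans
    (condProb_solSeries_single hκ hC hρ t 0 A).symm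
  Z_integrable := integrable_solSeries hκ hC hρ
  Z_condMean := condMean_solSeries hκ hC hρ

omit hC hρ in
-- The count process is a shift-equivariant image of the i.i.d. innovations, and factors of ergodic
-- systems are ergodic.
theorem ergodic_sol : IsErgodicProcess (fun t e => solCount a₀ a b κ e t) (noise ρ) := by
  have hmeas : Measurable fun (e : ℤ → Innov) t => solCount a₀ a b κ e t :=
    measurable_pi_lambda _ (measurable_solCount' hκ)
  have hmp : MeasurePreserving (fun (e : ℤ → Innov) t => solCount a₀ a b κ e t) (noise ρ)
    (pathLaw (fun t e => solCount a₀ a b κ e t) (noise ρ)) := ⟨hmeas, rfl⟩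
  refine hmp.ergodic_of_ergodic_semiconj (f := shiftSeq) (ergodic_shiftSeq (innovLaw ρ))
    measurable_shift fun e => ?_
  funext t
  exact solCount_shiftSeq e t

end Solution

theorem shift_iterate (n : ℕ) (x : ℤ → ℕ) (t : ℤ) : shift^[n] x t = x (t + n) :=
  shiftSeq_iterate n x t

/-- Strict stationarity follows from the invariance of the law of the process. -/
theorem isStrictlyStationary_of_measurePreserving {Ω : Type*} [MeasurableSpace Ω] {μ : Measure Ω}
    {X : ℤ → Ω → ℕ} (hX : ∀ t, Measurable (X t))
    (h : MeasurePreserving shift (pathLaw X μ) (pathLaw X μ)) : IsStrictlyStationary X μ := by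
  have hXm : Measurable fun ω t => X t ω := measurable_pi_lambda _ hX
  have hnat : ∀ (n : ℕ) (τ : Fin n → ℤ) (k : ℕ),
      μ.map (fun ω i => X (τ i + k) ω) = μ.map (fun ω i => X (τ i) ω) := by
    intro n τ k
    have h1 := (h.iterate k).map_eq
    have hτ : Measurable fun (x : ℤ → ℕ) (i : Fin n) => x (τ i) := by fun_prop
    have h2 := congrArg (Measure.map fun (x : ℤ → ℕ) (i : Fin n) => x (τ i)) h1
    rw [Measure.map_map hτ (h.iterate k).measurable, pathLaw, Measure.map_map hτ hXm,
      Measure.map_map (hτ.comp (h.iterate k).measurable) hXm] at h2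
    have h3 : (((fun (x : ℤ → ℕ) (i : Fin n) => x (τ i)) ∘ shift^[k]) ∘ fun ω t => X t ω)
        = fun ω i => X (τ i + k) ω := by
      funext ω i
      simp [shift_iterate]
    rw [h3] at h2
    exact h2
  intro n τ k
  rcases Int.eq_nat_or_neg k with ⟨l, rfl | rfl⟩
  · exact hnat n τ l
  -- A negative shift is undone by applying the forward invariance to the times `τ i - l`.
  · have := hnat n (fun i => τ i + -(l : ℤ)) l
    rw [← this]
    congr 1
    funext ω i
    simp

/-! ### One-step law of an arbitrary solution -/

/-- The counting series driven by uniform variables. -/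
def quantileSeq (κ : ℝ≥0 → Measure ℕ) (m : ℝ≥0) (u : ℕ → ℝ) : ℕ → ℕ := fun j => quantile κ m (u j)

theorem IsCountSemigroup.measurable_quantileSeq {κ : ℝ≥0 → Measure ℕ} (hκ : IsCountSemigroup κ) :
    Measurable fun x : ℝ≥0 × (ℕ → ℝ) => quantileSeq κ x.1 x.2 :=
  measurable_pi_lambda _ fun j => hκ.measurable_quantile.comp
    (by fun_prop : Measurable fun x : ℝ≥0 × (ℕ → ℝ) => (x.1, x.2 j))

theorem IsCountSemigroup.infinitePi_quantileSeq {κ : ℝ≥0 → Measure ℕ} (hκ : IsCountSemigroup κ)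
    (m : ℝ≥0) (s : Finset ℕ) (A : ℕ → Set ℕ) :
    (Measure.infinitePi fun _ : ℕ => unif) (quantileSeq κ m ⁻¹' (s : Set ℕ).pi A)
      = ∏ j ∈ s, κ m (A j) := by
  have hmeas : Measurable (quantile κ m) := hκ.measurable_quantile.comp measurable_prodMk_left
  have h1 : quantileSeq κ m ⁻¹' (s : Set ℕ).pi A
      = (s : Set ℕ).pi fun j => quantile κ m ⁻¹' A j := by
    ext i; simp [quantileSeq]
  rw [h1, Measure.infinitePi_pi _ (fun j _ => hmeas .of_discrete)]
  refine Finset.prod_congr rfl fun j _ => ?_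
  rw [← Measure.map_apply hmeas .of_discrete, hκ.map_quantile]

theorem past_le {Ω : Type*} [mΩ : MeasurableSpace Ω] {X : ℤ → Ω → ℕ} {M : ℤ → Ω → ℝ}
    (hX : ∀ t, Measurable (X t)) (hM : ∀ t, Measurable (M t)) (t : ℤ) : past X M t ≤ mΩ :=
  iSup_le fun s => ((hX s).prodMk (hM s)).comap_le

/-- The conditional mean at time `t`, as a function of the past. -/
def predMean {Ω : Type*} {p q : ℕ} (a₀ : ℝ≥0) (a : Fin p → ℝ≥0) (b : Fin q → ℝ≥0)
    (X : ℤ → Ω → ℕ) (M : ℤ → Ω → ℝ) (t : ℤ) (ω : Ω) : ℝ≥0 :=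
  meanRec a₀ a b (fun s => X s ω) (fun s => (M s ω).toNNReal) t

section OneStep

variable {Ω : Type*} [mΩ : MeasurableSpace Ω] {μ : Measure Ω} [IsProbabilityMeasure μ]
  {p q : ℕ} {a₀ : ℝ≥0} {a : Fin p → ℝ≥0} {b : Fin q → ℝ≥0} {κ : ℝ≥0 → Measure ℕ}
  {ρ : Measure ℕ} [IsProbabilityMeasure ρ] {φ : ℝ → ℂ}
  {X : ℤ → Ω → ℕ} {M : ℤ → Ω → ℝ} {ε : ℤ → Ω → ℕ} {Z : ℤ → ℕ → Ω → ℕ}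

omit mΩ in
theorem measurable_predMean (t : ℤ) : Measurable[past X M t] (predMean a₀ a b X M t) :=
  measurable_past_meanRec X M t

variable (h : IsCompoundingCMEM μ (a₀ : ℝ) (fun i => (a i : ℝ)) (fun j => (b j : ℝ)) ρ X M ε Z)
include h

omit [IsProbabilityMeasure μ] [IsProbabilityMeasure ρ] in
theorem predMean_ae_eq (t : ℤ) : ∀ᵐ ω ∂μ, M t ω = predMean a₀ a b X M t ω := by
  filter_upwards [h.M_rec t, ae_all_iff.2 h.M_pos] with ω h1 h2
  rw [h1, predMean, meanRec]
  push_cast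
  congr 1
  exact Finset.sum_congr rfl fun j _ => by rw [Real.coe_toNNReal _ (h2 _).le]

omit [IsProbabilityMeasure μ] [IsProbabilityMeasure ρ] in
theorem measurable_predMean' (t : ℤ) : Measurable (predMean a₀ a b X M t) :=
  (measurable_predMean t).mono (past_le h.measurable_X h.measurable_M t) le_rfl

variable (hcp : HasCPCountingSeries μ φ X M Z) (hκ : IsCountSemigroup κ)
  (hφ : ∀ (m : ℝ≥0) u, charFun ((κ m).map (fun k : ℕ => (k : ℝ))) u = cpCharFun φ m u)
include hcp hκ hφ

omit [IsProbabilityMeasure ρ] in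
-- On every event `B` of the past both finite measures have the same characteristic function: one
-- side by the prescribed conditional characteristic function, the other because a uniform variable
-- realises `κ` through its quantile.
theorem map_restrict_series (t : ℤ) (j : ℕ) {B : Set Ω} (hB : MeasurableSet[past X M t] B) :
    (μ.restrict B).map (Z t j) = ((μ.restrict B).prod unif).map
      fun x => quantile κ (predMean a₀ a b X M t x.1) x.2 := by
  have hle := past_le h.measurable_X h.measurable_M t
  have hm := measurable_predMean' h t
  have hZ := h.measurable_Z t j
  have hg : Measurable fun x : Ω × ℝ => quantile κ (predMean a₀ a b X M t x.1) x.2 :=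
    hκ.measurable_quantile.comp
      (by fun_prop : Measurable fun x : Ω × ℝ => (predMean a₀ a b X M t x.1, x.2))
  refine eq_of_charFun_map_natCast fun u => ?_
  have hnorm : ∀ k : ℕ, ‖Complex.exp (u * k * Complex.I)‖ ≤ 1 := by
    intro k
    have : ((u : ℂ) * k * Complex.I) = ((u * k : ℝ) : ℂ) * Complex.I := by push_cast; ring
    rw [this, Complex.norm_exp_ofReal_mul_I]
  have hint : Integrable (fun ω => Complex.exp (Complex.I * (u : ℂ) * (Z t j ω : ℂ))) μ := by
    refine Integrable.of_bound (C := 1) (Measurable.aestronglyMeasurable (by fun_prop))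
      (.of_forall fun ω => ?_)
    have hcomm : Complex.I * (u : ℂ) * (Z t j ω : ℂ) = u * (Z t j ω : ℂ) * Complex.I := by ring
    rw [hcomm]
    exact hnorm _
  rw [charFun_map_natCast, charFun_map_natCast, integral_map hZ.aemeasurable .of_discrete,
    integral_map hg.aemeasurable .of_discrete, integral_prod]
  · calc ∫ ω in B, Complex.exp (u * (Z t j ω : ℂ) * Complex.I) ∂μ
        = ∫ ω in B, Complex.exp (Complex.I * (u : ℂ) * (Z t j ω : ℂ)) ∂μ := by
          congr 1 with ω
          congr 1
          ring
      _ = ∫ ω in B, (μ[fun ω => Complex.exp (Complex.I * (u : ℂ) * (Z t j ω : ℂ)) |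
            past X M t]) ω ∂μ := (setIntegral_condExp hle hint hB).symm
      _ = _ := by
          refine integral_congr_ae (ae_restrict_of_ae ?_)
          filter_upwards [hcp t j u, predMean_ae_eq h t] with ω h1 h2
          have hq : Measurable (quantile κ (predMean a₀ a b X M t ω)) :=
            hκ.measurable_quantile.comp measurable_prodMk_left
          rw [h1, h2, ← hφ, charFun_map_natCast, ← hκ.map_quantile,
            integral_map hq.aemeasurable .of_discrete]
  · exact Integrable.of_bound (C := 1) (Measurable.aestronglyMeasurable (by fun_prop))
      (.of_forall fun x => hnorm _)

omit [IsProbabilityMeasure ρ] in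
-- This passes from characteristic functions to conditional probabilities, the form in which
-- conditional independence of the series is given.
theorem condProb_series (t : ℤ) (j : ℕ) (A : Set ℕ) :
    μ⟦Z t j ⁻¹' A | past X M t⟧
      =ᵐ[μ] fun ω => (κ (predMean a₀ a b X M t ω)).real A := by
  have hle := past_le h.measurable_X h.measurable_M t
  have hm := measurable_predMean' h t
  have hZ := h.measurable_Z t j
  have hg : Measurable fun x : Ω × ℝ => quantile κ (predMean a₀ a b X M t x.1) x.2 :=
    hκ.measurable_quantile.comp
      (by fun_prop : Measurable fun x : Ω × ℝ => (predMean a₀ a b X M t x.1, x.2))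
  have hS : MeasurableSet {x : ℝ≥0 × ℝ | quantile κ x.1 x.2 ∈ A} :=
    hκ.measurable_quantile .of_discrete
  have hκu : ∀ m, κ m A = unif (Prod.mk m ⁻¹' {x : ℝ≥0 × ℝ | quantile κ x.1 x.2 ∈ A}) := by
    intro m
    have hq : Measurable (quantile κ m) := hκ.measurable_quantile.comp measurable_prodMk_left
    rw [← hκ.map_quantile m, Measure.map_apply hq .of_discrete]
    rfl
  have hκm : Measurable fun m => κ m A := by
    simp_rw [hκu]
    exact measurable_measure_prodMk_left hS
  have hle1 : ∀ m, (κ m).real A ≤ 1 := fun m => by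
    have := hκ.prob m
    exact measureReal_le_one
  have hmeas : Measurable fun m => (κ m).real A := hκm.ennreal_toReal
  symm
  refine ae_eq_condExp_of_forall_setIntegral_eq hle ?_ (fun B _ _ => ?_) (fun B hB _ => ?_) ?_
  · exact (integrable_const (1 : ℝ)).indicator (hZ .of_discrete)
  · refine Integrable.of_bound (C := 1) (hmeas.comp hm).aestronglyMeasurable
      (.of_forall fun ω => ?_)
    rw [Real.norm_of_nonneg measureReal_nonneg]
    exact hle1 _
  · have h1 := congrArg (fun ν : Measure ℕ => ν A) (map_restrict_series h hcp hκ hφ t j hB)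
    beta_reduce at h1
    rw [Measure.map_apply hZ .of_discrete, Measure.map_apply hg .of_discrete,
      Measure.prod_apply (hg .of_discrete)] at h1
    have h2 : ∀ ω, unif (Prod.mk ω ⁻¹' ((fun x : Ω × ℝ =>
        quantile κ (predMean a₀ a b X M t x.1) x.2) ⁻¹' A)) = κ (predMean a₀ a b X M t ω) A :=
      fun ω => by
        rw [hκu]
        congr 1
    simp only [h2] at h1
    rw [integral_indicator (hZ .of_discrete), setIntegral_const, smul_eq_mul, mul_one,
      measureReal_def, h1, integral_eq_lintegral_of_nonneg_ae (.of_forall fun ω => measureReal_nonneg)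
        (hmeas.comp hm).aestronglyMeasurable]
    congr 1
    refine lintegral_congr fun ω => ?_
    have := hκ.prob (predMean a₀ a b X M t ω)
    exact ofReal_measureReal
  · exact (hmeas.comp (measurable_predMean t)).aestronglyMeasurable

omit [IsProbabilityMeasure ρ] in
theorem condProb_seriesSeq (t : ℤ) (s : Finset ℕ) (A : ℕ → Set ℕ) :
    μ⟦⋂ j ∈ s, Z t j ⁻¹' A j | past X M t⟧
      =ᵐ[μ] fun ω => ∏ j ∈ s, (κ (predMean a₀ a b X M t ω)).real (A j) := by
  have h4 : ∀ᵐ ω ∂μ, ∀ j ∈ s, (μ⟦Z t j ⁻¹' A j | past X M t⟧) ω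
      = (κ (predMean a₀ a b X M t ω)).real (A j) :=
    (Filter.eventually_all_finset s).2 fun j _ => condProb_series h hcp hκ hφ t j (A j)
  filter_upwards [h.Z_condIndep t s A, h4] with ω h5 h6
  rw [h5, Finset.prod_apply]
  exact Finset.prod_congr rfl h6

omit [IsProbabilityMeasure ρ] in
theorem measure_inter_series (t : ℤ) (s : Finset ℕ) (A : ℕ → Set ℕ) {B : Set Ω}
    (hB : MeasurableSet[past X M t] B) :
    μ.restrict B (⋂ j ∈ s, Z t j ⁻¹' A j)
      = ∫⁻ ω in B, ∏ j ∈ s, κ (predMean a₀ a b X M t ω) (A j) ∂μ := by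
  have hle := past_le h.measurable_X h.measurable_M t
  have hpm : MeasurableSet (⋂ j ∈ s, Z t j ⁻¹' A j) :=
    Finset.measurableSet_biInter _ fun j _ => h.measurable_Z t j .of_discrete
  have hae := condProb_seriesSeq h hcp hκ hφ t s A
  have h3 : ∫ ω in B, (⋂ j ∈ s, Z t j ⁻¹' A j).indicator (fun _ => (1 : ℝ)) ω ∂μ
      = ∫ ω in B, ∏ j ∈ s, (κ (predMean a₀ a b X M t ω)).real (A j) ∂μ := by
    rw [← setIntegral_condExp hle ((integrable_const (1 : ℝ)).indicator hpm) hB]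
    exact integral_congr_ae (ae_restrict_of_ae hae)
  rw [integral_indicator hpm, setIntegral_const, smul_eq_mul, mul_one] at h3
  rw [← ofReal_measureReal, h3,
    ofReal_integral_eq_lintegral_ofReal (integrable_condExp.congr hae).integrableOn
      (.of_forall fun ω => Finset.prod_nonneg fun _ _ => measureReal_nonneg)]
  refine lintegral_congr fun ω => ?_
  have := hκ.prob (predMean a₀ a b X M t ω)
  rw [ENNReal.ofReal_prod_of_nonneg fun _ _ => measureReal_nonneg]
  exact Finset.prod_congr rfl fun j _ => ofReal_measureReal

omit [IsProbabilityMeasure ρ] in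
theorem map_restrict_seriesSeq (t : ℤ) {B : Set Ω} (hB : MeasurableSet[past X M t] B) :
    (μ.restrict B).map (fun ω j => Z t j ω)
      = ((μ.restrict B).prod (Measure.infinitePi fun _ : ℕ => unif)).map
        fun x => quantileSeq κ (predMean a₀ a b X M t x.1) x.2 := by
  have hm := measurable_predMean' h t
  have hZ : Measurable fun ω j => Z t j ω := measurable_pi_lambda _ (h.measurable_Z t)
  have hg : Measurable fun x : Ω × (ℕ → ℝ) => quantileSeq κ (predMean a₀ a b X M t x.1) x.2 :=
    hκ.measurable_quantileSeq.comp
      (by fun_prop : Measurable fun x : Ω × (ℕ → ℝ) => (predMean a₀ a b X M t x.1, x.2))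
  have hpi : IsPiSystem (squareCylinders fun _ : ℕ => {s : Set ℕ | MeasurableSet s}) :=
    isPiSystem_squareCylinders (fun _ => MeasurableSpace.isPiSystem_measurableSet)
      (fun _ => by simp)
  refine ext_of_generate_finite _ (generateFrom_squareCylinders (α := fun _ : ℕ => ℕ)).symm
    hpi ?_ ?_
  · rintro _ ⟨s, A, -, rfl⟩
    have hsm : MeasurableSet ((s : Set ℕ).pi A) :=
      MeasurableSet.pi s.countable_toSet fun _ _ => .of_discrete
    have hpre : (fun ω j => Z t j ω) ⁻¹' (s : Set ℕ).pi A = ⋂ j ∈ s, Z t j ⁻¹' A j := by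
      ext ω; simp
    rw [Measure.map_apply hZ hsm, Measure.map_apply hg hsm, Measure.prod_apply (hg hsm), hpre,
      measure_inter_series h hcp hκ hφ t s A hB]
    refine lintegral_congr fun ω => ?_
    rw [← hκ.infinitePi_quantileSeq]
    rfl
  · rw [Measure.map_apply hZ .univ, Measure.map_apply hg .univ]
    simp [← Set.univ_prod_univ]

theorem map_restrict_innov (t : ℤ) {B : Set Ω} (hB : MeasurableSet[past X M t] B) :
    (μ.restrict B).map (fun ω => (ε t ω, fun j => Z t j ω))
      = ((μ.restrict B).prod (innovLaw ρ)).map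
        fun x => (x.2.1, quantileSeq κ (predMean a₀ a b X M t x.1) x.2.2) := by
  have hle := past_le h.measurable_X h.measurable_M t
  have hm := measurable_predMean' h t
  have hε := h.measurable_ε t
  have hZ : Measurable fun ω j => Z t j ω := measurable_pi_lambda _ (h.measurable_Z t)
  have hg : Measurable fun x : Ω × (ℕ → ℝ) => quantileSeq κ (predMean a₀ a b X M t x.1) x.2 :=
    hκ.measurable_quantileSeq.comp
      (by fun_prop : Measurable fun x : Ω × (ℕ → ℝ) => (predMean a₀ a b X M t x.1, x.2))
  have hg' : Measurable fun x : Ω × Innov =>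
      (x.2.1, quantileSeq κ (predMean a₀ a b X M t x.1) x.2.2) :=
    Measurable.prodMk (by fun_prop) (hκ.measurable_quantileSeq.comp
      (by fun_prop : Measurable fun x : Ω × Innov => (predMean a₀ a b X M t x.1, x.2.2)))
  have hZsup : Measurable[past X M t ⊔ ⨆ j, MeasurableSpace.comap (Z t j) inferInstance]
      fun ω j => Z t j ω := by
    refine (@measurable_pi_iff _ _ _ (_) _ _).2 fun j => ?_
    exact (comap_measurable (Z t j)).mono ((le_iSup (fun j =>
      MeasurableSpace.comap (Z t j) inferInstance) j).trans le_sup_right) le_rfl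
  have hsup : past X M t ⊔ ⨆ j, MeasurableSpace.comap (Z t j) inferInstance ≤ mΩ :=
    sup_le hle (iSup_le fun j => (h.measurable_Z t j).comap_le)
  have hind := map_restrict_prodMk_of_indep hsup hε.comap_le (h.ε_indep_past t).symm hZsup
    (comap_measurable (ε t)) (B := B) ((le_sup_left : past X M t ≤ _) B hB)
  refine Measure.ext_prod fun {S T} hS hT => ?_
  rw [Measure.map_apply (hε.prodMk hZ) (hS.prod hT), Measure.map_apply hg' (hS.prod hT),
    Measure.prod_apply (hg' (hS.prod hT))]
  have h1 : (μ.restrict B) ((fun ω => (ε t ω, fun j => Z t j ω)) ⁻¹' S ×ˢ T)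
      = ((μ.restrict B).map (fun ω j => Z t j ω)) T * ρ S := by
    rw [← h.ε_law t, ← Measure.prod_prod, ← hind, Measure.map_apply (hZ.prodMk hε) (hT.prod hS)]
    congr 1
    ext ω
    simp [and_comm]
  rw [h1, map_restrict_seriesSeq h hcp hκ hφ t hB, Measure.map_apply hg hT,
    Measure.prod_apply (hg hT), mul_comm, ← lintegral_const_mul _
      (measurable_measure_prodMk_left (hg hT))]
  refine lintegral_congr fun ω => ?_
  rw [innovLaw, ← Measure.prod_prod]
  congr 1

/-- Jointly with any function of the past, the next count has the law obtained from the predicted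
mean and a fresh innovation. Only laws are compared, so the original space need not carry the
uniform variables. -/
theorem map_prodMk_count {β : Type*} [MeasurableSpace β] (t : ℤ) {W : Ω → β}
    (hW : Measurable[past X M t] W) :
    μ.map (fun ω => (W ω, X t ω)) = (μ.prod (innovLaw ρ)).map
      fun x => (W x.1, compound κ (predMean a₀ a b X M t x.1) x.2) := by
  have hle := past_le h.measurable_X h.measurable_M t
  have hm := measurable_predMean' h t
  have hW' : Measurable W := hW.mono hle le_rfl
  have hε := h.measurable_ε t
  have hZ : Measurable fun ω j => Z t j ω := measurable_pi_lambda _ (h.measurable_Z t)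
  have hc : Measurable fun x : Ω × Innov => compound κ (predMean a₀ a b X M t x.1) x.2 :=
    hκ.measurable_compound.comp
      (by fun_prop : Measurable fun x : Ω × Innov => (predMean a₀ a b X M t x.1, x.2))
  have hsum : Measurable fun y : ℕ × (ℕ → ℕ) => ∑ j ∈ Finset.range y.1, y.2 j := by
    refine measurable_from_prod_countable_right fun n => ?_
    change Measurable fun z : ℕ → ℕ => ∑ j ∈ Finset.range n, z j
    fun_prop
  have hg' : Measurable fun x : Ω × Innov =>
      (x.2.1, quantileSeq κ (predMean a₀ a b X M t x.1) x.2.2) :=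
    Measurable.prodMk (by fun_prop) (hκ.measurable_quantileSeq.comp
      (by fun_prop : Measurable fun x : Ω × Innov => (predMean a₀ a b X M t x.1, x.2.2)))
  have hX := h.measurable_X t
  refine Measure.ext_prod fun {S T} hS hT => ?_
  rw [Measure.map_apply (hW'.prodMk hX) (hS.prod hT),
    Measure.map_apply (Measurable.prodMk (by fun_prop) hc) (hS.prod hT)]
  have h1 := congrArg (fun ν => (ν.map fun y : ℕ × (ℕ → ℕ) => ∑ j ∈ Finset.range y.1, y.2 j) T)
    (map_restrict_innov h hcp hκ hφ t (hW hS))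
  beta_reduce at h1
  rw [Measure.map_map hsum (hε.prodMk hZ), Measure.map_map hsum hg',
    Measure.map_apply (hsum.comp (hε.prodMk hZ)) hT, Measure.map_apply (hsum.comp hg') hT,
    Measure.restrict_apply (hsum.comp (hε.prodMk hZ) hT)] at h1
  have h2 : μ ((fun ω => (W ω, X t ω)) ⁻¹' S ×ˢ T)
      = μ ((fun y : ℕ × (ℕ → ℕ) => ∑ j ∈ Finset.range y.1, y.2 j) ∘
        (fun ω => (ε t ω, fun j => Z t j ω)) ⁻¹' T ∩ W ⁻¹' S) := by
    apply measure_congr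
    filter_upwards [h.X_eq t] with ω hω
    apply propext
    change (W ω ∈ S ∧ X t ω ∈ T) ↔ (∑ j ∈ Finset.range (ε t ω), Z t j ω ∈ T ∧ W ω ∈ S)
    rw [hω, and_comm]
  rw [h2, h1]
  have h3 : (μ.restrict (W ⁻¹' S)).prod (innovLaw ρ)
      = (μ.prod (innovLaw ρ)).restrict ((W ⁻¹' S) ×ˢ Set.univ) := by
    rw [← Measure.prod_restrict, Measure.restrict_univ]
  rw [h3, Measure.restrict_apply (hsum.comp hg' hT)]
  congr 1
  ext x
  change (_ ∈ T ∧ (W x.1 ∈ S ∧ True)) ↔ (W x.1 ∈ S ∧ _ ∈ T)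
  rw [and_true, and_comm]
  rfl

end OneStep

/-! ### Contraction of coupled histories -/

/-- At `θ = 1` the weighted sum is the coefficient sum, which is below one; by continuity it stays
below one for some `θ` slightly smaller. -/
theorem exists_contraction_rate {p q : ℕ} (a : Fin p → ℝ≥0) (b : Fin q → ℝ≥0)
    (hab : ∑ i, a i + ∑ j, b j < 1) : ∃ θ : ℝ≥0, 0 < θ ∧ θ < 1 ∧
      ∑ i, a i * θ ^ (-(1 + (i : ℤ))) + ∑ j, b j * θ ^ (-(1 + (j : ℤ))) ≤ 1 := by
  have hcont : ContinuousAt (fun θ : ℝ≥0 =>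
      ∑ i, a i * θ ^ (-(1 + (i : ℤ))) + ∑ j, b j * θ ^ (-(1 + (j : ℤ)))) 1 := by
    have h : ∀ k : ℤ, ContinuousAt (fun θ : ℝ≥0 => θ ^ k) 1 := fun k =>
      continuousAt_zpow₀ _ _ (.inl one_ne_zero)
    unfold ContinuousAt
    exact (tendsto_finsetSum _ fun i _ => tendsto_const_nhds.mul (h _)).add
      (tendsto_finsetSum _ fun i _ => tendsto_const_nhds.mul (h _))
  have h1 := hcont.eventually (gt_mem_nhds (show _ < (1 : ℝ≥0) by simpa using hab))
  have h2 : ∀ᶠ θ : ℝ≥0 in nhdsWithin 1 (Set.Iio 1), 0 < θ ∧ θ < 1 ∧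
      ∑ i, a i * θ ^ (-(1 + (i : ℤ))) + ∑ j, b j * θ ^ (-(1 + (j : ℤ))) ≤ 1 := by
    filter_upwards [nhdsWithin_le_nhds h1, self_mem_nhdsWithin,
      nhdsWithin_le_nhds (lt_mem_nhds (zero_lt_one' ℝ≥0))] with θ h3 h4 h5
    exact ⟨h5, h4, h3.le⟩
  have : (nhdsWithin (1 : ℝ≥0) (Set.Iio 1)).NeBot := nhdsLT_neBot_of_exists_lt ⟨0, zero_lt_one⟩
  exact h2.exists

/-- Histories: counts and conditional means, the coordinates from the present on being irrelevant. -/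
abbrev Hist : Type := (ℤ → ℕ) × (ℤ → ℝ≥0)

section Coupling

variable {p q : ℕ} (a₀ : ℝ≥0) (a : Fin p → ℝ≥0) (b : Fin q → ℝ≥0) (κ : ℝ≥0 → Measure ℕ)

/-- One step of the dynamics: the coordinates at time `t` are computed from the earlier ones and
the innovations. -/
def step (t : ℤ) (x : Hist × Innov) : Hist :=
  (Function.update x.1.1 t (compound κ (meanRec a₀ a b x.1.1 x.1.2 t) x.2),
    Function.update x.1.2 t (meanRec a₀ a b x.1.1 x.1.2 t))

/-- A family of laws of histories up to each time, consistent with the dynamics and with bounded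
means. -/
structure IsHistoryLaw (ρ : Measure ℕ) (C : ℝ≥0) (η : ℤ → Measure Hist) : Prop where
  prob : ∀ t, IsProbabilityMeasure (η t)
  step_eq : ∀ t, η (t + 1) = ((η t).prod (innovLaw ρ)).map (step a₀ a b κ t)
  count_le : ∀ t r, r < t → ∫⁻ w, (w.1 r : ℝ≥0∞) ∂(η t) ≤ C
  mean_le : ∀ t r, r < t → ∫⁻ w, (w.2 r : ℝ≥0∞) ∂(η t) ≤ C

/-- The coupling of two families of laws, independent up to time `s` and driven by the same
innovations from then on. -/
def coupling (ρ : Measure ℕ) (η η' : ℤ → Measure Hist) (s : ℤ) : ℕ → Measure (Hist × Hist)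
  | 0 => (η s).prod (η' s)
  | n + 1 => ((coupling ρ η η' s n).prod (innovLaw ρ)).map fun x =>
      (step a₀ a b κ (s + n) (x.1.1, x.2), step a₀ a b κ (s + n) (x.1.2, x.2))

variable {a₀ a b κ}

theorem enorm_meanRec_sub_le (x x' : ℤ → ℕ) (m m' : ℤ → ℝ≥0) (t : ℤ) :
    ‖(meanRec a₀ a b x m t : ℝ) - meanRec a₀ a b x' m' t‖ₑ
      ≤ ∑ i : Fin p, a i * ‖(x (t - 1 - (i : ℤ)) : ℝ) - x' (t - 1 - (i : ℤ))‖ₑ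
        + ∑ j : Fin q, b j * ‖(m (t - 1 - (j : ℤ)) : ℝ) - m' (t - 1 - (j : ℤ))‖ₑ := by
  have h : (meanRec a₀ a b x m t : ℝ) - meanRec a₀ a b x' m' t
      = ∑ i : Fin p, (a i : ℝ) * ((x (t - 1 - (i : ℤ)) : ℝ) - x' (t - 1 - (i : ℤ)))
        + ∑ j : Fin q, (b j : ℝ) * ((m (t - 1 - (j : ℤ)) : ℝ) - m' (t - 1 - (j : ℤ))) := by
    unfold meanRec
    push_cast
    simp only [mul_sub, Finset.sum_sub_distrib]
    ring
  have hnn : ∀ r : ℝ≥0, ‖(r : ℝ)‖ₑ = r := fun r => by simp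
  rw [h]
  refine (enorm_add_le _ _).trans (add_le_add ?_ ?_) <;>
  · refine (enorm_sum_le _ _).trans (Finset.sum_le_sum fun i _ => ?_)
    rw [enorm_mul, hnn]

theorem measurable_step (hκ : IsCountSemigroup κ) (t : ℤ) : Measurable (step a₀ a b κ t) := by
  have h1 : Measurable fun x : Hist × Innov => meanRec a₀ a b x.1.1 x.1.2 t :=
    measurable_meanRec (fun s _ => by fun_prop) (fun s _ => by fun_prop)
  have h2 : Measurable fun x : Hist × Innov =>
      compound κ (meanRec a₀ a b x.1.1 x.1.2 t) x.2 :=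
    hκ.measurable_compound.comp (h1.prodMk measurable_snd)
  refine Measurable.prodMk ?_ ?_
  · refine measurable_pi_iff.2 fun s => ?_
    rcases eq_or_ne s t with rfl | hs
    · simpa using h2
    · simp only [Function.update_of_ne hs]
      fun_prop
  · refine measurable_pi_iff.2 fun s => ?_
    rcases eq_or_ne s t with rfl | hs
    · simpa using h1
    · simp only [Function.update_of_ne hs]
      fun_prop

variable {ρ : Measure ℕ} [IsProbabilityMeasure ρ] (hκ : IsCountSemigroup κ)
  {C C' : ℝ≥0} {η η' : ℤ → Measure Hist}
include hκ

theorem measurable_step_pair (t : ℤ) : Measurable fun x : (Hist × Hist) × Innov =>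
    (step a₀ a b κ t (x.1.1, x.2), step a₀ a b κ t (x.1.2, x.2)) :=
  ((measurable_step hκ t).comp (by fun_prop :
    Measurable fun x : (Hist × Hist) × Innov => (x.1.1, x.2))).prodMk
  ((measurable_step hκ t).comp (by fun_prop :
    Measurable fun x : (Hist × Hist) × Innov => (x.1.2, x.2)))

variable (hη : IsHistoryLaw a₀ a b κ ρ C η) (hη' : IsHistoryLaw a₀ a b κ ρ C' η')
include hη hη'

theorem isProbabilityMeasure_coupling (s : ℤ) (n : ℕ) :
    IsProbabilityMeasure (coupling a₀ a b κ ρ η η' s n) := by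
  have := hη.prob s
  have := hη'.prob s
  induction n with
  | zero => unfold coupling; infer_instance
  | succ n ih =>
    exact Measure.isProbabilityMeasure_map (measurable_step_pair hκ _).aemeasurable

theorem coupling_fst (s : ℤ) (n : ℕ) :
    (coupling a₀ a b κ ρ η η' s n).map Prod.fst = η (s + n) := by
  have := hη.prob s
  have := hη'.prob s
  induction n with
  | zero => simp [coupling]
  | succ n ih =>
    have := isProbabilityMeasure_coupling hκ hη hη' s n
    rw [coupling, Measure.map_map measurable_fst (measurable_step_pair hκ _), Nat.cast_succ,
      ← add_assoc, hη.step_eq, ← ih]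
    have h := Measure.map_prod_map (coupling a₀ a b κ ρ η η' s n) (innovLaw ρ)
      (f := Prod.fst) (g := id) measurable_fst measurable_id
    rw [Measure.map_id] at h
    rw [h, Measure.map_map (measurable_step hκ _) (by fun_prop)]
    rfl

theorem coupling_snd (s : ℤ) (n : ℕ) :
    (coupling a₀ a b κ ρ η η' s n).map Prod.snd = η' (s + n) := by
  have := hη.prob s
  have := hη'.prob s
  induction n with
  | zero => simp [coupling]
  | succ n ih =>
    have := isProbabilityMeasure_coupling hκ hη hη' s n
    rw [coupling, Measure.map_map measurable_snd (measurable_step_pair hκ _), Nat.cast_succ,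
      ← add_assoc, hη'.step_eq, ← ih]
    have h := Measure.map_prod_map (coupling a₀ a b κ ρ η η' s n) (innovLaw ρ)
      (f := Prod.snd) (g := id) measurable_snd measurable_id
    rw [Measure.map_id] at h
    rw [h, Measure.map_map (measurable_step hκ _) (by fun_prop)]
    rfl

/-- Induction on `n`. A step rewrites only coordinate `s + n`; there common innovations reduce the
distance of counts to that of means, and the linear recursion bounds the latter by earlier
distances. The choice of `θ` absorbs the lags. -/
theorem lintegral_coupling_le (hρ : ∫⁻ k, (k : ℝ≥0∞) ∂ρ = 1) {θ : ℝ≥0} (hθ0 : 0 < θ) (hθ1 : θ < 1)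
    (hθ : ∑ i, a i * θ ^ (-(1 + (i : ℤ))) + ∑ j, b j * θ ^ (-(1 + (j : ℤ))) ≤ 1) (s : ℤ) (n : ℕ) :
    ∀ r < s + n,
      ∫⁻ w, ‖(w.1.1 r : ℝ) - w.2.1 r‖ₑ ∂(coupling a₀ a b κ ρ η η' s n)
        ≤ ((C + C') * θ ^ (r - s) : ℝ≥0) ∧
      ∫⁻ w, ‖(w.1.2 r : ℝ) - w.2.2 r‖ₑ ∂(coupling a₀ a b κ ρ η η' s n)
        ≤ ((C + C') * θ ^ (r - s) : ℝ≥0) := by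
  have := hη.prob s
  have := hη'.prob s
  induction n with
  | zero =>
    intro r hr
    simp only [Nat.cast_zero, add_zero] at hr
    -- Before the start, `r - s ≤ 0` and `θ < 1` make the power at least one, so the crude bound `C
    -- + C'` suffices.
    have hK : ((C : ℝ≥0∞) + C') ≤ ((C + C') * θ ^ (r - s) : ℝ≥0) := by
      rw [← ENNReal.coe_add, ENNReal.coe_le_coe]
      exact le_mul_of_one_le_right zero_le
        (one_le_zpow_of_nonpos₀ hθ0 hθ1.le (by lia))
    have hfst := coupling_fst hκ hη hη' s 0
    have hsnd := coupling_snd hκ hη hη' s 0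
    simp only [Nat.cast_zero, add_zero] at hfst hsnd
    constructor
    · refine le_trans ?_ hK
      calc ∫⁻ w, ‖(w.1.1 r : ℝ) - w.2.1 r‖ₑ ∂(coupling a₀ a b κ ρ η η' s 0)
          ≤ ∫⁻ w, ((w.1.1 r : ℝ≥0∞) + w.2.1 r) ∂(coupling a₀ a b κ ρ η η' s 0) := by
            refine lintegral_mono fun w => ?_
            refine (enorm_sub_le).trans ?_
            simp
        _ = ∫⁻ w, (w.1 r : ℝ≥0∞) ∂(η s) + ∫⁻ w, (w.1 r : ℝ≥0∞) ∂(η' s) := by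
            rw [lintegral_add_left (by fun_prop), ← hfst, ← hsnd,
              lintegral_map (by fun_prop) measurable_fst,
              lintegral_map (by fun_prop) measurable_snd]
        _ ≤ C + C' := add_le_add (hη.count_le s r hr) (hη'.count_le s r hr)
    · refine le_trans ?_ hK
      calc ∫⁻ w, ‖(w.1.2 r : ℝ) - w.2.2 r‖ₑ ∂(coupling a₀ a b κ ρ η η' s 0)
          ≤ ∫⁻ w, ((w.1.2 r : ℝ≥0∞) + w.2.2 r) ∂(coupling a₀ a b κ ρ η η' s 0) := by
            refine lintegral_mono fun w => ?_
            refine (enorm_sub_le).trans ?_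
            simp
        _ = ∫⁻ w, (w.2 r : ℝ≥0∞) ∂(η s) + ∫⁻ w, (w.2 r : ℝ≥0∞) ∂(η' s) := by
            rw [lintegral_add_left (by fun_prop), ← hfst, ← hsnd,
              lintegral_map (by fun_prop) measurable_fst,
              lintegral_map (by fun_prop) measurable_snd]
        _ ≤ C + C' := add_le_add (hη.mean_le s r hr) (hη'.mean_le s r hr)
  | succ n ih =>
    intro r hr
    have := isProbabilityMeasure_coupling hκ hη hη' s n
    have hpush : ∀ {G : Hist × Hist → ℝ≥0∞}, Measurable G →
        ∫⁻ w, G w ∂(coupling a₀ a b κ ρ η η' s (n + 1))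
          = ∫⁻ w, ∫⁻ i, G (step a₀ a b κ (s + n) (w.1, i), step a₀ a b κ (s + n) (w.2, i))
              ∂(innovLaw ρ) ∂(coupling a₀ a b κ ρ η η' s n) := by
      intro G hG
      rw [coupling, lintegral_map hG (measurable_step_pair hκ _)]
      exact lintegral_prod (fun x : (Hist × Hist) × Innov => G (step a₀ a b κ (s + n) (x.1.1, x.2),
        step a₀ a b κ (s + n) (x.1.2, x.2))) (hG.comp (measurable_step_pair hκ _)).aemeasurable
    rw [hpush (by fun_prop), hpush (by fun_prop)]
    rcases eq_or_ne r (s + n) with rfl | hne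
    · simp only [step, Function.update_self, lintegral_const, measure_univ, mul_one]
      simp only [hκ.lintegral_enorm_compound_sub hρ, and_self]
      calc ∫⁻ w, ‖(meanRec a₀ a b w.1.1 w.1.2 (s + n) : ℝ) - meanRec a₀ a b w.2.1 w.2.2 (s + n)‖ₑ
            ∂(coupling a₀ a b κ ρ η η' s n)
          ≤ ∫⁻ w, (∑ i : Fin p, a i * ‖(w.1.1 (s + n - 1 - (i : ℤ)) : ℝ)
                - w.2.1 (s + n - 1 - (i : ℤ))‖ₑ
              + ∑ j : Fin q, b j * ‖(w.1.2 (s + n - 1 - (j : ℤ)) : ℝ)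
                - w.2.2 (s + n - 1 - (j : ℤ))‖ₑ) ∂(coupling a₀ a b κ ρ η η' s n) :=
            lintegral_mono fun w => enorm_meanRec_sub_le _ _ _ _ _
        _ = ∑ i : Fin p, a i * ∫⁻ w, ‖(w.1.1 (s + n - 1 - (i : ℤ)) : ℝ)
                - w.2.1 (s + n - 1 - (i : ℤ))‖ₑ ∂(coupling a₀ a b κ ρ η η' s n)
              + ∑ j : Fin q, b j * ∫⁻ w, ‖(w.1.2 (s + n - 1 - (j : ℤ)) : ℝ)
                - w.2.2 (s + n - 1 - (j : ℤ))‖ₑ ∂(coupling a₀ a b κ ρ η η' s n) := by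
            rw [lintegral_add_left (by fun_prop), lintegral_finsetSum _ (fun i _ => by fun_prop),
              lintegral_finsetSum _ (fun i _ => by fun_prop)]
            congr 1
            · exact Finset.sum_congr rfl fun i _ => lintegral_const_mul _ (by fun_prop)
            · exact Finset.sum_congr rfl fun i _ => lintegral_const_mul _ (by fun_prop)
        _ ≤ ∑ i : Fin p, (a i : ℝ≥0∞) * ((C + C') * θ ^ (s + n - 1 - (i : ℤ) - s) : ℝ≥0)
              + ∑ j : Fin q, (b j : ℝ≥0∞) * ((C + C') * θ ^ (s + n - 1 - (j : ℤ) - s) : ℝ≥0) := by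
            gcongr with i _ j _
            · exact (ih _ (by lia)).1
            · exact (ih _ (by lia)).2
        _ = (((C + C') * θ ^ (s + n - s) * (∑ i, a i * θ ^ (-(1 + (i : ℤ)))
              + ∑ j, b j * θ ^ (-(1 + (j : ℤ)))) : ℝ≥0) : ℝ≥0∞) := by
            -- Index `i` stands for lag `i + 1`, hence the exponent `-(1 + i)`.
            have hz : ∀ i : ℤ, θ ^ (s + n - 1 - i - s) = θ ^ (s + n - s) * θ ^ (-(1 + i)) := by
              intro i
              rw [← zpow_add₀ hθ0.ne']
              congr 1
              ring
            simp only [hz, mul_add, Finset.mul_sum]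
            push_cast
            congr 1
            · exact Finset.sum_congr rfl fun i _ => by ring
            · exact Finset.sum_congr rfl fun i _ => by ring
        _ ≤ ((C + C') * θ ^ (s + n - s) : ℝ≥0) := by
            rw [ENNReal.coe_le_coe]
            exact mul_le_of_le_one_right zero_le hθ
    · simp only [step, Function.update_of_ne hne, lintegral_const, measure_univ, mul_one]
      exact ih r (by push_cast at hr; lia)

/-- The coupling is started `n` steps before `t`. Distinct integers are at distance at least one, so
disagreement at a time in `F` has probability at most the mean distance, of order `θ ^ n`. One
inequality is enough, since the two families can be exchanged. -/
theorem measure_restrict_le (hρ : ∫⁻ k, (k : ℝ≥0∞) ∂ρ = 1) (hab : ∑ i, a i + ∑ j, b j < 1)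
    (t : ℤ) (F : Finset ℤ) (hF : ∀ r ∈ F, r < t) {S : Set (F → ℕ)} (hS : MeasurableSet S) :
    η t {w | F.restrict w.1 ∈ S} ≤ η' t {w | F.restrict w.1 ∈ S} := by
  obtain ⟨θ, hθ0, hθ1, hθ⟩ := exists_contraction_rate a b hab
  have hA : MeasurableSet {w : Hist | F.restrict w.1 ∈ S} :=
    (by fun_prop : Measurable fun w : Hist => F.restrict w.1) hS
  have hbound : ∀ n : ℕ, η t {w | F.restrict w.1 ∈ S} ≤ η' t {w | F.restrict w.1 ∈ S}
      + ((∑ r ∈ F, (C + C') * θ ^ (r - t) * θ ^ n : ℝ≥0) : ℝ≥0∞) := by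
    intro n
    have hfst := coupling_fst hκ hη hη' (t - n) n
    have hsnd := coupling_snd hκ hη hη' (t - n) n
    rw [sub_add_cancel] at hfst hsnd
    have hdec := lintegral_coupling_le hκ hη hη' hρ hθ0 hθ1 hθ (t - n) n
    rw [sub_add_cancel] at hdec
    set Γ := coupling a₀ a b κ ρ η η' (t - n) n
    rw [← hfst, ← hsnd, Measure.map_apply measurable_fst hA, Measure.map_apply measurable_snd hA]
    have hne : ∀ r ∈ F, Γ {w | w.1.1 r ≠ w.2.1 r} ≤ ((C + C') * θ ^ (r - t) * θ ^ n : ℝ≥0) := by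
      intro r hr
      have h1 := mul_meas_ge_le_lintegral (μ := Γ)
        (f := fun w : Hist × Hist => ‖(w.1.1 r : ℝ) - w.2.1 r‖ₑ) (by fun_prop) 1
      rw [one_mul] at h1
      have h2 : θ ^ (r - (t - n)) = θ ^ (r - t) * θ ^ n := by
        rw [← zpow_natCast, ← zpow_add₀ hθ0.ne']
        congr 1
        ring
      refine (measure_mono fun w hw => ?_).trans (h1.trans ?_)
      · change (1 : ℝ≥0∞) ≤ ‖(w.1.1 r : ℝ) - w.2.1 r‖ₑ
        have h3 : ((w.1.1 r : ℤ) - w.2.1 r) ≠ 0 := by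
          intro h0
          exact hw (by lia)
        have h4 := Int.one_le_abs h3
        rw [← ofReal_norm, ENNReal.one_le_ofReal, Real.norm_eq_abs]
        exact_mod_cast h4
      · rw [mul_assoc, ← h2]
        exact (hdec r (hF r hr)).1
    calc Γ (Prod.fst ⁻¹' {w | F.restrict w.1 ∈ S})
        ≤ Γ (Prod.snd ⁻¹' {w | F.restrict w.1 ∈ S} ∪ ⋃ r ∈ F, {w | w.1.1 r ≠ w.2.1 r}) := by
          refine measure_mono fun w hw => ?_
          by_cases hall : ∀ r ∈ F, w.1.1 r = w.2.1 r
          · left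
            have : F.restrict w.2.1 = F.restrict w.1.1 := by
              ext r
              exact (hall r r.2).symm
            change F.restrict w.2.1 ∈ S
            rw [this]
            exact hw
          · right
            push Not at hall
            simpa using hall
      _ ≤ Γ (Prod.snd ⁻¹' {w | F.restrict w.1 ∈ S})
          + ∑ r ∈ F, Γ {w | w.1.1 r ≠ w.2.1 r} :=
          (measure_union_le _ _).trans (add_le_add le_rfl (measure_biUnion_finset_le _ _))
      _ ≤ _ := by
          push_cast
          gcongr with r hr
          exact_mod_cast hne r hr
  refine ge_of_tendsto' (x := Filter.atTop) ?_ hbound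
  have h0 : Filter.Tendsto (fun n : ℕ => ((∑ r ∈ F, (C + C') * θ ^ (r - t) * θ ^ n : ℝ≥0) : ℝ≥0∞))
      Filter.atTop (nhds ((∑ r ∈ F, (C + C') * θ ^ (r - t) * 0 : ℝ≥0) : ℝ≥0∞)) := by
    rw [ENNReal.tendsto_coe]
    exact tendsto_finsetSum _ fun r _ => tendsto_const_nhds.mul
      (tendsto_pow_atTop_nhds_zero_of_lt_one zero_le hθ1)
  simpa using tendsto_const_nhds.add h0

end Coupling

/-! ### Uniqueness in law -/

/-- The history of a solution before time `t`. -/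
def history {Ω : Type*} (X : ℤ → Ω → ℕ) (M : ℤ → Ω → ℝ) (t : ℤ) (ω : Ω) : Hist :=
  (fun s => if s < t then X s ω else 0, fun s => if s < t then (M s ω).toNNReal else 0)

theorem measurable_history {Ω : Type*} (X : ℤ → Ω → ℕ) (M : ℤ → Ω → ℝ) (t : ℤ) :
    Measurable[past X M t] (history X M t) := by
  have h1 : ∀ s, Measurable[past X M t] fun ω => (history X M t ω).1 s := by
    intro s
    by_cases hs : s < t
    · simp only [history, hs, if_true]
      exact measurable_fst.comp (measurable_past X M hs)
    · simpa only [history, hs, if_false] using measurable_const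
  have h2 : ∀ s, Measurable[past X M t] fun ω => (history X M t ω).2 s := by
    intro s
    by_cases hs : s < t
    · simp only [history, hs, if_true]
      exact (measurable_snd.comp (measurable_past X M hs)).real_toNNReal
    · simpa only [history, hs, if_false] using measurable_const
  let _ := past X M t
  exact (measurable_pi_lambda _ h1).prodMk (measurable_pi_lambda _ h2)

section Uniqueness

variable {Ω : Type*} [MeasurableSpace Ω] {μ : Measure Ω} [IsProbabilityMeasure μ]
  {p q : ℕ} {a₀ : ℝ≥0} {a : Fin p → ℝ≥0} {b : Fin q → ℝ≥0} {κ : ℝ≥0 → Measure ℕ}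
  {ρ : Measure ℕ} [IsProbabilityMeasure ρ] {φ : ℝ → ℂ}
  {X : ℤ → Ω → ℕ} {M : ℤ → Ω → ℝ} {ε : ℤ → Ω → ℕ} {Z : ℤ → ℕ → Ω → ℕ}

omit [MeasurableSpace Ω] in
theorem meanRec_history (t : ℤ) (ω : Ω) :
    meanRec a₀ a b (history X M t ω).1 (history X M t ω).2 t = predMean a₀ a b X M t ω :=
  meanRec_congr (fun s hs => by simp [history, hs]) fun s hs => by simp [history, hs]

/-- This turns the assumed bound on the means of the counts into the bound on the conditional means
needed for a history law. -/
theorem lintegral_mean_eq_lintegral_count (hκ : IsCountSemigroup κ)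
    (hφ : ∀ (m : ℝ≥0) u, charFun ((κ m).map (fun k : ℕ => (k : ℝ))) u = cpCharFun φ m u)
    (hρ : ∫⁻ k, (k : ℝ≥0∞) ∂ρ = 1)
    (h : IsCompoundingCMEM μ (a₀ : ℝ) (fun i => (a i : ℝ)) (fun j => (b j : ℝ)) ρ X M ε Z)
    (hcp : HasCPCountingSeries μ φ X M Z) (t : ℤ) :
    ∫⁻ ω, ((M t ω).toNNReal : ℝ≥0∞) ∂μ = ∫⁻ ω, (X t ω : ℝ≥0∞) ∂μ := by
  have hm := measurable_predMean' h t
  have hX := h.measurable_X t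
  have hc : Measurable fun x : Ω × Innov => compound κ (predMean a₀ a b X M t x.1) x.2 :=
    hκ.measurable_compound.comp
      (by fun_prop : Measurable fun x : Ω × Innov => (predMean a₀ a b X M t x.1, x.2))
  have h1 := congrArg (fun ν : Measure (Unit × ℕ) => ∫⁻ y, (y.2 : ℝ≥0∞) ∂ν)
    (map_prodMk_count h hcp hκ hφ t (W := fun _ : Ω => ()) measurable_const)
  beta_reduce at h1
  rw [lintegral_map (by fun_prop) (by fun_prop), lintegral_map (by fun_prop) (by fun_prop),
    lintegral_prod _ (Measurable.aemeasurable (by fun_prop))] at h1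
  simp only [hκ.lintegral_compound hρ] at h1
  rw [h1]
  refine lintegral_congr_ae ?_
  filter_upwards [predMean_ae_eq h t] with ω hω
  rw [hω, Real.toNNReal_coe]

theorem isHistoryLaw_of_solution (hκ : IsCountSemigroup κ)
    (hφ : ∀ (m : ℝ≥0) u, charFun ((κ m).map (fun k : ℕ => (k : ℝ))) u = cpCharFun φ m u)
    (hρ : ∫⁻ k, (k : ℝ≥0∞) ∂ρ = 1)
    (h : IsCompoundingCMEM μ (a₀ : ℝ) (fun i => (a i : ℝ)) (fun j => (b j : ℝ)) ρ X M ε Z)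
    (hcp : HasCPCountingSeries μ φ X M Z) {C : ℝ≥0}
    (hC : ∀ t, ∫⁻ ω, (X t ω : ℝ≥0∞) ∂μ ≤ C) :
    IsHistoryLaw a₀ a b κ ρ C fun t => μ.map (history X M t) := by
  have hW : ∀ t, Measurable (history X M t) := fun t =>
    (measurable_history X M t).mono (past_le h.measurable_X h.measurable_M t) le_rfl
  refine ⟨fun t => Measure.isProbabilityMeasure_map (hW t).aemeasurable, fun t => ?_,
    fun t r hr => ?_, fun t r hr => ?_⟩
  · have hm := measurable_predMean' h t
    have hc : Measurable fun x : Ω × Innov => compound κ (predMean a₀ a b X M t x.1) x.2 :=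
      hκ.measurable_compound.comp
        (by fun_prop : Measurable fun x : Ω × Innov => (predMean a₀ a b X M t x.1, x.2))
    -- The next history is a deterministic function of the present one and the new count, so
    -- `map_prodMk_count` gives its law.
    let G : Hist × ℕ → Hist := fun y => (Function.update y.1.1 t y.2,
      Function.update y.1.2 t (meanRec a₀ a b y.1.1 y.1.2 t))
    have hG : Measurable G := by
      have h1 : Measurable fun x : Hist × ℕ => meanRec a₀ a b x.1.1 x.1.2 t :=
        measurable_meanRec (fun s _ => by fun_prop) (fun s _ => by fun_prop)
      refine Measurable.prodMk ?_ ?_ <;>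
      · refine measurable_pi_iff.2 fun s => ?_
        rcases eq_or_ne s t with rfl | hs
        · simp only [Function.update_self]
          fun_prop
        · simp only [Function.update_of_ne hs]
          fun_prop
    have hnext : history X M (t + 1) =ᵐ[μ] fun ω => G (history X M t ω, X t ω) := by
      filter_upwards [predMean_ae_eq h t] with ω hω
      refine Prod.ext (funext fun s => ?_) (funext fun s => ?_)
      · rcases eq_or_ne s t with rfl | hs
        · simp [history, G]
        · have : s ≤ t ↔ s < t := by lia
          simp [history, G, Function.update_of_ne hs, this]
      · rcases eq_or_ne s t with rfl | hs
        · simp only [G, Function.update_self, meanRec_history]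
          simp [history, hω]
        · have : s ≤ t ↔ s < t := by lia
          simp [history, G, Function.update_of_ne hs, this]
    have hmp := Measure.map_prod_map μ (innovLaw ρ) (hW t) measurable_id
    rw [Measure.map_id] at hmp
    have h2 := congrArg (Measure.map G) (map_prodMk_count h hcp hκ hφ t (measurable_history X M t))
    rw [Measure.map_map hG ((hW t).prodMk (h.measurable_X t)),
      Measure.map_map hG (Measurable.prodMk (by fun_prop) hc)] at h2
    rw [Measure.map_congr hnext, hmp, Measure.map_map (measurable_step hκ t)
      (by fun_prop)]
    refine h2.trans (congrArg (fun f => Measure.map f _) (funext fun x => ?_))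
    simp only [Function.comp_apply, step, G, Prod.map_fst, Prod.map_snd, id_eq, meanRec_history]
  · rw [lintegral_map (by fun_prop) (hW t)]
    simpa [history, hr] using hC r
  · rw [lintegral_map (by fun_prop) (hW t)]
    have := (lintegral_mean_eq_lintegral_count hκ hφ hρ h hcp r).trans_le (hC r)
    simpa [history, hr] using this

variable {Ω' : Type*} [MeasurableSpace Ω'] {μ' : Measure Ω'} [IsProbabilityMeasure μ']
  {X' : ℤ → Ω' → ℕ} {M' : ℤ → Ω' → ℝ} {ε' : ℤ → Ω' → ℕ} {Z' : ℤ → ℕ → Ω' → ℕ}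

/-- The law of the count process of a solution with bounded means is determined by the model. -/
theorem pathLaw_eq_of_solutions (hκ : IsCountSemigroup κ)
    (hφ : ∀ (m : ℝ≥0) u, charFun ((κ m).map (fun k : ℕ => (k : ℝ))) u = cpCharFun φ m u)
    (hρ : ∫⁻ k, (k : ℝ≥0∞) ∂ρ = 1) (hab : ∑ i, a i + ∑ j, b j < 1)
    (h : IsCompoundingCMEM μ (a₀ : ℝ) (fun i => (a i : ℝ)) (fun j => (b j : ℝ)) ρ X M ε Z)
    (hcp : HasCPCountingSeries μ φ X M Z) (hX : HasBoundedMeans μ X)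
    (h' : IsCompoundingCMEM μ' (a₀ : ℝ) (fun i => (a i : ℝ)) (fun j => (b j : ℝ)) ρ X' M' ε' Z')
    (hcp' : HasCPCountingSeries μ' φ X' M' Z') (hX' : HasBoundedMeans μ' X') :
    pathLaw X μ = pathLaw X' μ' := by
  obtain ⟨C, hC⟩ := hX
  obtain ⟨C', hC'⟩ := hX'
  have hη := isHistoryLaw_of_solution hκ hφ hρ h hcp hC
  have hη' := isHistoryLaw_of_solution hκ hφ hρ h' hcp' hC'
  have hm : Measurable fun ω t => X t ω := measurable_pi_lambda _ h.measurable_X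
  have hm' : Measurable fun ω t => X' t ω := measurable_pi_lambda _ h'.measurable_X
  have hW : ∀ t, Measurable (history X M t) := fun t =>
    (measurable_history X M t).mono (past_le h.measurable_X h.measurable_M t) le_rfl
  have hW' : ∀ t, Measurable (history X' M' t) := fun t =>
    (measurable_history X' M' t).mono (past_le h'.measurable_X h'.measurable_M t) le_rfl
  have : IsProbabilityMeasure (pathLaw X μ) := Measure.isProbabilityMeasure_map hm.aemeasurable
  have : IsProbabilityMeasure (pathLaw X' μ') := Measure.isProbabilityMeasure_map hm'.aemeasurable
  refine ext_of_generate_finite _ (generateFrom_measurableCylinders (α := fun _ : ℤ => ℕ)).symm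
    isPiSystem_measurableCylinders (fun A hA => ?_) (by simp)
  obtain ⟨F, S, hS, rfl⟩ := (mem_measurableCylinders _).1 hA
  -- A cylinder involves finitely many times; a history ending after all of them decides it.
  obtain ⟨t, ht⟩ : ∃ t : ℤ, ∀ r ∈ F, r < t := by
    obtain ⟨t, ht⟩ := F.exists_le
    exact ⟨t + 1, fun r hr => by have := ht r hr; lia⟩
  have hA : MeasurableSet {w : Hist | F.restrict w.1 ∈ S} :=
    (by fun_prop : Measurable fun w : Hist => F.restrict w.1) hS
  have heq := le_antisymm (measure_restrict_le hκ hη hη' hρ hab t F ht hS)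
    (measure_restrict_le hκ hη' hη hρ hab t F ht hS)
  rw [Measure.map_apply (hW t) hA, Measure.map_apply (hW' t) hA] at heq
  have hS' : MeasurableSet (cylinder (α := fun _ : ℤ => ℕ) F S) := hS.cylinder F
  rw [pathLaw, pathLaw, Measure.map_apply hm hS', Measure.map_apply hm' hS']
  convert heq using 2
  · ext ω
    have : F.restrict (history X M t ω).1 = F.restrict fun t => X t ω := by
      ext r
      simp [history, ht r r.2]
    change F.restrict (fun t => X t ω) ∈ S ↔ F.restrict (history X M t ω).1 ∈ S
    rw [this]
  · ext ω
    have : F.restrict (history X' M' t ω).1 = F.restrict fun t => X' t ω := by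
      ext r
      simp [history, ht r r.2]
    change F.restrict (fun t => X' t ω) ∈ S ↔ F.restrict (history X' M' t ω).1 ∈ S
    rw [this]

end Uniqueness

end CMEM

end

open CMEM

/-! ### Conclusion -/

theorem theorem3p1p1 {p q : ℕ} (_hp : 1 ≤ p)
    (a₀ : ℝ) (ha₀ : 0 < a₀)
    (a : Fin p → ℝ) (ha : ∀ i, 0 ≤ a i)
    (b : Fin q → ℝ) (hb : ∀ j, 0 ≤ b j)
    (hab : ∑ i, a i + ∑ j, b j < 1)
    -- the distribution of the innovations: mean one, finite variance
    (ρ : Measure ℕ) [IsProbabilityMeasure ρ]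
    (hρ_var : MemLp (fun k : ℕ => (k : ℝ)) 2 ρ)
    (hρ_mean : ∫ k, (k : ℝ) ∂ρ = 1)
    -- the characteristic function of a distribution on the real line
    (Q : Measure ℝ) [IsProbabilityMeasure Q]
    (hφ_diff : DifferentiableAt ℝ (charFun Q) 0)
    (hφ_deriv : deriv (charFun Q) 0 ≠ 0) :
    -- every such process with bounded means is strictly stationary and ergodic
    (∀ {Ω : Type*} [MeasurableSpace Ω] (μ : Measure Ω) [IsProbabilityMeasure μ]
        (X : ℤ → Ω → ℕ) (M : ℤ → Ω → ℝ) (ε : ℤ → Ω → ℕ) (Z : ℤ → ℕ → Ω → ℕ),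
        CMEM.IsCompoundingCMEM μ a₀ a b ρ X M ε Z →
        CMEM.HasCPCountingSeries μ (charFun Q) X M Z →
        CMEM.HasBoundedMeans μ X →
        CMEM.IsStrictlyStationary X μ ∧ CMEM.IsErgodicProcess X μ) ∧
    -- and such a process exists
    (CMEM.GeneratesCounts (charFun Q) →
      ∃ (Ω : Type) (_ : MeasurableSpace Ω) (μ : Measure Ω) (_ : IsProbabilityMeasure μ)
        (X : ℤ → Ω → ℕ) (M : ℤ → Ω → ℝ) (ε : ℤ → Ω → ℕ) (Z : ℤ → ℕ → Ω → ℕ),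
        CMEM.IsCompoundingCMEM μ a₀ a b ρ X M ε Z ∧
        CMEM.HasCPCountingSeries μ (charFun Q) X M Z ∧
        CMEM.HasBoundedMeans μ X ∧
        CMEM.IsStrictlyStationary X μ ∧ CMEM.IsErgodicProcess X μ) := by
  have hρ : ∫⁻ k, (k : ℝ≥0∞) ∂ρ = 1 := by
    have hint : Integrable (fun k : ℕ => (k : ℝ)) ρ := hρ_var.integrable (by norm_num)
    have h := ofReal_integral_eq_lintegral_ofReal hint (.of_forall fun k => Nat.cast_nonneg k)
    rw [hρ_mean, ENNReal.ofReal_one] at h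
    simpa using h.symm
  lift a₀ to ℝ≥0 using ha₀.le
  lift a to Fin p → ℝ≥0 using ha
  lift b to Fin q → ℝ≥0 using hb
  have ha₀' : 0 < a₀ := by exact_mod_cast ha₀
  have hab' : ∑ i, a i + ∑ j, b j < 1 := by
    rw [← NNReal.coe_lt_coe]
    push_cast
    exact hab
  obtain ⟨C, hC⟩ : ∃ C : ℝ≥0, a₀ + (∑ i, a i + ∑ j, b j) * C ≤ C := by
    set s := ∑ i, a i + ∑ j, b j
    have hs : (s : ℝ) < 1 := by exact_mod_cast hab'
    -- The fixed point of `C = a₀ + s C`, the stationary mean.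
    refine ⟨a₀ / (1 - s), ?_⟩
    rw [← NNReal.coe_le_coe]
    push_cast [NNReal.coe_sub hab'.le]
    have : (1 - (s : ℝ)) ≠ 0 := by linarith
    apply le_of_eq
    field_simp
    ring
  have hsol : ∀ κ : ℝ≥0 → Measure ℕ, IsCountSemigroup κ →
      IsStrictlyStationary (fun t e => solCount a₀ a b κ e t) (noise ρ) ∧
        IsErgodicProcess (fun t e => solCount a₀ a b κ e t) (noise ρ) := fun κ hκ =>
    ⟨isStrictlyStationary_of_measurePreserving (measurable_solCount' hκ)
      (ergodic_sol hκ).toMeasurePreserving, ergodic_sol hκ⟩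
  refine ⟨fun {Ω} _ μ _ X M ε Z h hcp hX => ?_, fun hgen => ?_⟩
  · have hgen : GeneratesCounts (charFun Q) := generatesCounts_of_solution (past X M 0) μ
      (past_le h.measurable_X h.measurable_M 0) (M 0) (h.measurable_M 0) (h.M_pos 0) (Z 0 0)
      (h.measurable_Z 0 0) Q hφ_diff hφ_deriv (hcp 0 0)
    obtain ⟨κ, hκ, hφ⟩ := exists_countSemigroup Q hφ_diff hφ_deriv hgen
    -- Ergodicity depends only on the path law, so it is transferred from the constructed solution.
    have hlaw := pathLaw_eq_of_solutions hκ hφ hρ hab' h hcp hX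
      (isCompoundingCMEM_sol hκ hC hρ ha₀') (condCharFun_solSeries hκ hC hρ hφ)
      ⟨C, lintegral_solCount_le hκ hC hρ⟩
    have herg : IsErgodicProcess X μ := by
      rw [IsErgodicProcess, hlaw]
      exact (hsol κ hκ).2
    exact ⟨isStrictlyStationary_of_measurePreserving h.measurable_X herg.toMeasurePreserving, herg⟩
  · obtain ⟨κ, hκ, hφ⟩ := exists_countSemigroup Q hφ_diff hφ_deriv hgen
    exact ⟨ℤ → Innov, inferInstance, noise ρ, inferInstance, _, _, _, _,
      isCompoundingCMEM_sol hκ hC hρ ha₀', condCharFun_solSeries hκ hC hρ hφ,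
      ⟨C, lintegral_solCount_le hκ hC hρ⟩, hsol κ hκ⟩
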